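/- Write $\mathbb{N}=\{1,2,\ldots\}$ and let $[n_1,\ldots,n_k]\ge 0$ be the least common multiple of the integers $n_1,\ldots,n_k$, which is $0$ if some $n_i=0$. For every integer $k\ge 2$ put $$C_k=\prod_p\left(1-\frac1p\right)^k\sum_{\nu_1,\ldots,\nu_k=0}^{\infty}\frac{1}{p^{2(\nu_1+\cdots+\nu_k)-\max(\nu_1,\ldots,\nu_k)}},$$ where $p$ runs over the primes; the series and the product converge. Then, for real $x\to\infty$, $$\sum_{\substack{n_1,\ldots,n_k\in\mathbb{N}\\ n_1^2+\cdots+n_k^2\le x}}[n_1,\ldots,n_k]=\frac{C_k}{2^k\,k!}x^k+R_k(x),\qquad \sum_{\substack{n_1,\ldots,n_k\in\mathbb{Z}\\ n_1^2+\cdots+n_k^2\le x}}[n_1,\ldots,n_k]=\frac{C_k}{k!}x^k+\widetilde R_k(x),$$ where, if $k\ge 3$, both $R_k(x)$ and $\widetilde R_k(x)$ are $O_{k,\varepsilon}(x^{k-1/4+\varepsilon})$ for every $\varepsilon>0$, and both $R_2(x)$ and $\widetilde R_2(x)$ are $O(x^{3/2}\log x)$. In particular, $$C_2=\frac{\zeta(3)}{\zeta(2)},\qquad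 C_3=\zeta(3)\,\zeta(5)\prod_p\left(1-\frac{3}{p^2}+\frac{4}{p^3}-\frac{3}{p^4}+\frac{1}{p^6}\right),$$ where the last product converges. -/

import Mathlib

open Filter Asymptotics

/-- The `k`-tuples of positive integers with `n₁² + ⋯ + n_k² ≤ x`. -/
def natBall (k : ℕ) (x : ℝ) : Set (Fin k → ℕ) :=
  {n | (∀ i, 1 ≤ n i) ∧ ∑ i, (n i : ℝ) ^ 2 ≤ x}

/-- The `k`-tuples of integers with `n₁² + ⋯ + n_k² ≤ x`. -/
def intBall (k : ℕ) (x : ℝ) : Set (Fin k → ℤ) :=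
  {n | ∑ i, (n i : ℝ) ^ 2 ≤ x}

theorem intBall_finite (k : ℕ) (x : ℝ) : (intBall k x).Finite := by
  refine (Set.finite_Icc (fun _ : Fin k => -⌊x⌋) (fun _ => ⌊x⌋)).subset ?_
  intro n hn
  have key : ∀ i, |n i| ≤ ⌊x⌋ := by
    intro i
    have h1 : (n i : ℝ) ^ 2 ≤ x :=
      (Finset.single_le_sum (f := fun i => (n i : ℝ) ^ 2)
        (fun j _ => sq_nonneg _) (Finset.mem_univ i)).trans hn
    have h2 : |n i| ≤ (n i) ^ 2 := by
      rw [← sq_abs]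
      exact Int.le_self_sq _
    rw [Int.le_floor]
    refine le_trans ?_ h1
    exact_mod_cast h2
  exact ⟨fun i => (abs_le.mp (key i)).1, fun i => (abs_le.mp (key i)).2⟩

theorem natBall_finite (k : ℕ) (x : ℝ) : (natBall k x).Finite := by
  refine Set.Finite.of_injOn (f := fun n i => (n i : ℤ)) (t := intBall k x) ?_ ?_
    (intBall_finite k x)
  · intro n hn
    simpa [intBall] using hn.2
  · intro m _ n _ h
    funext i
    have := congrFun h i
    simp only at this
    exact_mod_cast this

/-- The sum of `[n₁, …, n_k]` over positive integers with `n₁² + ⋯ + n_k² ≤ x`. -/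
noncomputable def natLcmSum (k : ℕ) (x : ℝ) : ℝ :=
  ∑ n ∈ (natBall_finite k x).toFinset, ((Finset.univ.lcm n : ℕ) : ℝ)

/-- The sum of `[n₁, …, n_k]` over integers with `n₁² + ⋯ + n_k² ≤ x`. Here `Finset.lcm` over `ℤ`
is the nonnegative least common multiple, and it is `0` if one of the entries is `0`. -/
noncomputable def intLcmSum (k : ℕ) (x : ℝ) : ℝ :=
  ∑ n ∈ (intBall_finite k x).toFinset, ((Finset.univ.lcm n : ℤ) : ℝ)

/-- The term `1 / p ^ (2 (ν₁ + ⋯ + ν_k) - max (ν₁, …, ν_k))`, with an integer exponent. -/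
noncomputable def eulerTerm (k : ℕ) (p : Nat.Primes) (ν : Fin k → ℕ) : ℝ :=
  1 / ((p : ℕ) : ℝ) ^ (2 * ∑ i, (ν i : ℤ) - ((Finset.univ.sup ν : ℕ) : ℤ))

/-- The Euler factor of `C_k` at the prime `p`. -/
noncomputable def eulerFactor (k : ℕ) (p : Nat.Primes) : ℝ :=
  (1 - 1 / ((p : ℕ) : ℝ)) ^ k * ∑' ν : Fin k → ℕ, eulerTerm k p ν

/-- The constant `C_k`, a product over all primes. -/
noncomputable def lcmConst (k : ℕ) : ℝ := ∏' p : Nat.Primes, eulerFactor k p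

/-- The factor `1 - 3/p² + 4/p³ - 3/p⁴ + 1/p⁶`. -/
noncomputable def cubicFactor (p : Nat.Primes) : ℝ :=
  1 - 3 / ((p : ℕ) : ℝ) ^ 2 + 4 / ((p : ℕ) : ℝ) ^ 3 - 3 / ((p : ℕ) : ℝ) ^ 4
    + 1 / ((p : ℕ) : ℝ) ^ 6

/-! The function `f(n) = [n₁, …, n_k] / (n₁ ⋯ n_k)` is multiplicative in `k` variables and is small
only through common factors. Write it as `f(n) = ∑ g(d)` over all tuples `d` with `dᵢ ∣ nᵢ`, where
`g` is its Möbius transform. Then the sum of `[n₁, …, n_k] = f(n) n₁ ⋯ n_k` over the ball equals `∑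
g(d) S_d(x)`, where `S_d(x)` is the sum of `n₁ ⋯ n_k` over the points of the ball with `dᵢ ∣ nᵢ`.
Comparison with an integral, one coordinate at a time, gives `S_d(x) = x^k / (2^k k! ∏ dᵢ)` with
relative error `≪ min(1, L/√x)`, where `L = [d₁, …, d_k]` (`abs_latticeSum_sub_le`).

All depends on how fast `∑ g(d) / ∏ dᵢ` converges. With the other coordinates fixed, `f` depends on
`nᵢ` only through the gcd of `nᵢ` with the lcm of the others, which forces `g(d) = 0` unless each
`dᵢ` divides the lcm of the others (`dvd_lcm_removeNth`). Every prime power dividing `L` then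
divides two entries, so `L² ∣ ∏ dᵢ` (`lcm_sq_dvd_prod`). At most `τ(L)^k` tuples have lcm `L`, and
`|g(d)| ≤ τ(L)^k`, so `∑ |g(d)| L^{1/2} / ∏ dᵢ` is dominated by `∑ τ(L)^{2k} L^{-3/2}`. As `min(1,
t) ≤ t^{1/2}`, the total relative error is `O(x^{-1/4})`.

Grouping the main term by `L` gives a multiplicative function of `L`, hence an Euler product, whose
factors are identified with those of `C_k` by a Cauchy product (`tsum_lcmWeight_prime_pow`). For `k
= 2`, `f = 1/gcd`, so `g` lives on the diagonal and is bounded by `1` there; the error becomes `∑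
c⁻² min(1, c/√x) ≪ log x / √x`. The values of `C_2` and `C_3` come from removing `1` from all
exponents `νᵢ` at once, which turns the local series into linear equations for themselves. -/

/-! ### Sums of `n₁ ⋯ n_k` over a ball under divisibility conditions -/

theorem mem_natBall_toFinset {k : ℕ} {x : ℝ} {n : Fin k → ℕ} :
    n ∈ (natBall_finite k x).toFinset ↔ (∀ i, 1 ≤ n i) ∧ ∑ i, (n i : ℝ) ^ 2 ≤ x := by
  simp [natBall]

theorem sum_natBall_succ {k : ℕ} {x : ℝ} (F : (Fin (k + 1) → ℕ) → ℝ) :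
    ∑ n ∈ (natBall_finite (k + 1) x).toFinset, F n =
      ∑ a ∈ Finset.Icc 1 ⌊√x⌋₊, ∑ n ∈ (natBall_finite k (x - (a : ℝ) ^ 2)).toFinset,
        F (Fin.cons a n) := by
  rw [Finset.sum_sigma']
  refine Finset.sum_bij' (fun n _ => ⟨n 0, Fin.tail n⟩) (fun s _ => Fin.cons s.1 s.2) ?_ ?_ ?_ ?_ ?_
  · intro n hn
    rw [mem_natBall_toFinset, Fin.sum_univ_succ] at hn
    have h0 : (n 0 : ℝ) ^ 2 ≤ x :=
      (le_add_of_nonneg_right (Finset.sum_nonneg fun i _ => sq_nonneg _)).trans hn.2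
    rw [Finset.mem_sigma, mem_natBall_toFinset, Finset.mem_Icc]
    refine ⟨⟨hn.1 0, Nat.le_floor (Real.le_sqrt_of_sq_le h0)⟩, fun i => hn.1 _, ?_⟩
    simp only [Fin.tail]
    linarith [hn.2]
  · rintro ⟨a, n⟩ h
    rw [Finset.mem_sigma, mem_natBall_toFinset, Finset.mem_Icc] at h
    rw [mem_natBall_toFinset, Fin.sum_univ_succ]
    refine ⟨fun i => ?_, ?_⟩
    · refine Fin.cases ?_ (fun j => ?_) i
      · simpa using h.1.1
      · simpa using h.2.1 j
    · have := h.2.2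
      simp only [Fin.cons_zero, Fin.cons_succ] at this ⊢
      linarith
  · intro n _
    simp
  · rintro ⟨a, n⟩ _
    simp
  · intro n _
    simp

/-- The sum of `n₁ ⋯ n_k` over the tuples of `natBall k x` with `dᵢ ∣ nᵢ` for all `i`. -/
noncomputable def latticeSum {k : ℕ} (d : Fin k → ℕ) (x : ℝ) : ℝ :=
  ∑ n ∈ (natBall_finite k x).toFinset, if ∀ i, d i ∣ n i then ∏ i, (n i : ℝ) else 0

theorem latticeSum_zero (d : Fin 0 → ℕ) {x : ℝ} (hx : 0 ≤ x) : latticeSum d x = 1 := by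
  have : (natBall_finite 0 x).toFinset = {d} := by
    ext n
    rw [mem_natBall_toFinset]
    simp [hx, Subsingleton.elim n d]
  simp [latticeSum, this]

theorem sum_Icc_dvd {d : ℕ} (hd : 1 ≤ d) {y : ℝ} (hy : 0 ≤ y) (φ : ℕ → ℝ) :
    ∑ a ∈ Finset.Icc 1 ⌊y⌋₊, (if d ∣ a then φ a else 0) =
      ∑ m ∈ Finset.Icc 1 ⌊y / d⌋₊, φ (d * m) := by
  rw [← Finset.sum_filter]
  have hd' : (0 : ℝ) < d := by exact_mod_cast hd
  refine Finset.sum_nbij' (fun a => a / d) (fun m => d * m) ?_ ?_ ?_ ?_ ?_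
  · intro a ha
    rw [Finset.mem_filter, Finset.mem_Icc] at ha
    obtain ⟨⟨h1, h2⟩, m, rfl⟩ := ha
    rw [Nat.mul_div_cancel_left _ hd, Finset.mem_Icc]
    refine ⟨Nat.pos_of_ne_zero fun h => by simp [h] at h1, Nat.le_floor ?_⟩
    rw [le_div_iff₀ hd']
    have := (Nat.le_floor_iff hy).1 h2
    push_cast at this
    linarith
  · intro m hm
    rw [Finset.mem_Icc] at hm
    rw [Finset.mem_filter, Finset.mem_Icc]
    refine ⟨⟨Nat.mul_pos hd hm.1, Nat.le_floor ?_⟩, dvd_mul_right _ _⟩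
    have := (Nat.le_floor_iff (by positivity)).1 hm.2
    rw [le_div_iff₀ hd'] at this
    push_cast
    linarith
  · intro a ha
    exact Nat.mul_div_cancel' (Finset.mem_filter.1 ha).2
  · intro m _
    exact Nat.mul_div_cancel_left _ hd
  · intro a ha
    rw [Nat.mul_div_cancel' (Finset.mem_filter.1 ha).2]

theorem latticeSum_succ {k : ℕ} {d : Fin (k + 1) → ℕ} (hd : 1 ≤ d 0) (x : ℝ) :
    latticeSum d x = ∑ m ∈ Finset.Icc 1 ⌊√x / d 0⌋₊,
      ((d 0 : ℝ) * m) * latticeSum (Fin.tail d) (x - ((d 0 : ℝ) * m) ^ 2) := by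
  have := sum_Icc_dvd hd (Real.sqrt_nonneg x)
    fun a => (a : ℝ) * latticeSum (Fin.tail d) (x - (a : ℝ) ^ 2)
  push_cast at this
  rw [← this, latticeSum, sum_natBall_succ]
  refine Finset.sum_congr rfl fun a _ => ?_
  split_ifs with h
  · rw [latticeSum, Finset.mul_sum]
    refine Finset.sum_congr rfl fun n _ => ?_
    have hiff : (∀ i, d i ∣ (Fin.cons a n : Fin (k + 1) → ℕ) i) ↔ ∀ i, Fin.tail d i ∣ n i := by
      simp [Fin.forall_fin_succ, h, Fin.tail]
    by_cases hn : ∀ i, Fin.tail d i ∣ n i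
    · rw [if_pos hn, if_pos (hiff.2 hn), Fin.prod_univ_succ]
      simp
    · rw [if_neg hn, if_neg fun h' => hn (hiff.1 h'), mul_zero]
  · refine Finset.sum_eq_zero fun n _ => ?_
    simp [Fin.forall_fin_succ, h]

theorem latticeSum_eq_zero {k : ℕ} {d : Fin k → ℕ} {x : ℝ} {i : Fin k} (h : √x < d i) :
    latticeSum d x = 0 := by
  refine Finset.sum_eq_zero fun n hn => if_neg fun hdvd => ?_
  rw [mem_natBall_toFinset] at hn
  have h1 : (d i : ℝ) ≤ n i := by exact_mod_cast Nat.le_of_dvd (hn.1 i) (hdvd i)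
  have h2 : (n i : ℝ) ^ 2 ≤ x := (Finset.single_le_sum (f := fun i => (n i : ℝ) ^ 2)
    (fun j _ => sq_nonneg _) (Finset.mem_univ i)).trans hn.2
  linarith [Real.le_sqrt_of_sq_le h2]

theorem hasDerivAt_mul_sub_sq_pow (y : ℝ) (k : ℕ) (t : ℝ) :
    HasDerivAt (fun t : ℝ => t * (y ^ 2 - t ^ 2) ^ k)
      ((y ^ 2 - t ^ 2) ^ k + t * (k * (y ^ 2 - t ^ 2) ^ (k - 1) * (-(2 * t)))) t := by
  have h1 : HasDerivAt (fun t : ℝ => y ^ 2 - t ^ 2) (-(2 * t)) t := by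
    simpa using ((hasDerivAt_id t).pow 2).const_sub (y ^ 2)
  have h2 := (hasDerivAt_id' t).fun_mul (h1.fun_pow k)
  rwa [one_mul] at h2

theorem hasDerivAt_sub_sq_pow_div (y : ℝ) (k : ℕ) (t : ℝ) :
    HasDerivAt (fun t : ℝ => -((y ^ 2 - t ^ 2) ^ (k + 1) / (2 * (k + 1))))
      (t * (y ^ 2 - t ^ 2) ^ k) t := by
  have h1 : HasDerivAt (fun t : ℝ => y ^ 2 - t ^ 2) (-(2 * t)) t := by
    simpa using ((hasDerivAt_id t).pow 2).const_sub (y ^ 2)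
  refine ((h1.fun_pow (k + 1)).div_const (2 * ((k : ℝ) + 1))).fun_neg.congr_deriv ?_
  have : (k : ℝ) + 1 ≠ 0 := by positivity
  rw [Nat.add_sub_cancel]
  push_cast
  field_simp

/-- Mean value inequality: of the two terms of the derivative, the first is at most `y ^ (2 * k)`
and the second at most `2 * k * y ^ (2 * k)` in absolute value. -/
theorem abs_mul_sub_sq_pow_sub_le {y : ℝ} (k : ℕ) {s t : ℝ} (hs : s ∈ Set.Icc 0 y)
    (ht : t ∈ Set.Icc 0 y) :
    |t * (y ^ 2 - t ^ 2) ^ k - s * (y ^ 2 - s ^ 2) ^ k| ≤ (2 * k + 1) * y ^ (2 * k) * |t - s| := by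
  refine (convex_Icc (0 : ℝ) y).norm_image_sub_le_of_norm_hasDerivWithin_le
    (fun u _ => (hasDerivAt_mul_sub_sq_pow y k u).hasDerivWithinAt) (fun u hu => ?_) hs ht
  have hy : 0 ≤ y := hu.1.trans hu.2
  have h0 : 0 ≤ y ^ 2 - u ^ 2 := by nlinarith [hu.1, hu.2]
  have h1 : y ^ 2 - u ^ 2 ≤ y ^ 2 := by nlinarith
  have h2 : u ^ 2 ≤ y ^ 2 := by linarith
  rw [Real.norm_eq_abs]
  refine (abs_add_le _ _).trans ?_
  rw [abs_of_nonneg (pow_nonneg h0 k)]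
  have h3 : (y ^ 2 - u ^ 2) ^ k ≤ y ^ (2 * k) := by
    rw [pow_mul]; exact pow_le_pow_left₀ h0 h1 k
  have h4 : |u * (k * (y ^ 2 - u ^ 2) ^ (k - 1) * (-(2 * u)))| ≤ 2 * k * y ^ (2 * k) := by
    rcases Nat.eq_zero_or_pos k with rfl | hk
    · simp
    · have : u * (k * (y ^ 2 - u ^ 2) ^ (k - 1) * (-(2 * u))) =
          -(2 * k * (u ^ 2 * (y ^ 2 - u ^ 2) ^ (k - 1))) := by ring
      rw [this, abs_neg, abs_of_nonneg (by positivity)]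
      have : y ^ (2 * k) = y ^ 2 * (y ^ 2) ^ (k - 1) := by
        rw [← pow_succ', Nat.sub_add_cancel hk, pow_mul]
      rw [this]
      gcongr
  linarith

/-- One rectangle, with height taken at the right endpoint, against the integral of `φ(t) = t (y² -
t²)^k`. With `F` a primitive of `φ`, the function `t φ(b) - F(t)` has derivative `φ(b) - φ(t)`,
which the Lipschitz bound makes `O(b - a)`. -/
theorem riemannSum_step {y : ℝ} (k : ℕ) {a b : ℝ} (ha : 0 ≤ a) (hab : a ≤ b) (hb : b ≤ y) :
    |(b - a) * (b * (y ^ 2 - b ^ 2) ^ k) -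
      ((y ^ 2 - a ^ 2) ^ (k + 1) / (2 * (k + 1)) - (y ^ 2 - b ^ 2) ^ (k + 1) / (2 * (k + 1)))| ≤
      (2 * k + 1) * y ^ (2 * k) * (b - a) ^ 2 := by
  have h := (convex_Icc a b).norm_image_sub_le_of_norm_hasDerivWithin_le
    (f := fun t => t * (b * (y ^ 2 - b ^ 2) ^ k) - -((y ^ 2 - t ^ 2) ^ (k + 1) / (2 * (k + 1))))
    (f' := fun t => 1 * (b * (y ^ 2 - b ^ 2) ^ k) - t * (y ^ 2 - t ^ 2) ^ k)
    (C := (2 * k + 1) * y ^ (2 * k) * (b - a)) (x := a) (y := b)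
    (fun u _ => (((hasDerivAt_id u).mul_const _).sub
      (hasDerivAt_sub_sq_pow_div y k u)).hasDerivWithinAt) (fun u hu => ?_)
    (Set.left_mem_Icc.2 hab) (Set.right_mem_Icc.2 hab)
  · rw [Real.norm_eq_abs, Real.norm_eq_abs, abs_of_nonneg (sub_nonneg.2 hab)] at h
    refine le_trans (le_of_eq ?_) (h.trans (le_of_eq ?_))
    · congr 1; ring
    · ring
  · rw [Real.norm_eq_abs, one_mul]
    have hy : 0 ≤ y := (ha.trans hab).trans hb
    refine (abs_mul_sub_sq_pow_sub_le k ⟨ha.trans hu.1, hu.2.trans hb⟩ ⟨ha.trans hab, hb⟩).trans ?_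
    rw [abs_of_nonneg (sub_nonneg.2 hu.2)]
    gcongr
    exact hu.1

/-- With `M = ⌊y / d⌋`, the `M` rectangles cost `(2k+1) d² y^(2k)` each, and `M d ≤ y`. The
uncovered piece from `d M` to `y` has length at most `d` and costs at most `d y^(2k+1)`. -/
theorem riemannSum_sub_le {y d : ℝ} (hy : 0 ≤ y) (hd : 0 < d) (k : ℕ) :
    |∑ m ∈ Finset.Icc 1 ⌊y / d⌋₊, d * ((d * m) * (y ^ 2 - (d * m) ^ 2) ^ k) -
      y ^ (2 * (k + 1)) / (2 * (k + 1))| ≤ (2 * k + 2) * d * y ^ (2 * k + 1) := by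
  have key : ∀ M : ℕ, d * M ≤ y →
      |∑ m ∈ Finset.Icc 1 M, d * ((d * m) * (y ^ 2 - (d * m) ^ 2) ^ k) -
        (y ^ (2 * (k + 1)) / (2 * (k + 1)) - (y ^ 2 - (d * M) ^ 2) ^ (k + 1) / (2 * (k + 1)))| ≤
        M * ((2 * k + 1) * y ^ (2 * k) * d ^ 2) := by
    intro M
    induction M with
    | zero => intro _; simp [pow_mul]
    | succ M ih =>
      intro hM
      have hle : d * M ≤ d * (M + 1 : ℕ) := by push_cast; nlinarith
      have h1 := ih (hle.trans hM)
      have h2 := riemannSum_step k (by positivity) hle hM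
      have h3 : d * (M + 1 : ℕ) - d * M = d := by push_cast; ring
      rw [h3] at h2
      rw [Finset.sum_Icc_succ_top (by omega)]
      refine le_trans (le_of_eq ?_) ((abs_add_le _ _).trans (add_le_add h1 h2) |>.trans
        (le_of_eq ?_))
      · congr 1; ring
      · push_cast; ring
  set M := ⌊y / d⌋₊ with hMdef
  have hM : d * M ≤ y := by
    have := Nat.floor_le (div_nonneg hy hd.le)
    rw [le_div_iff₀ hd] at this
    linarith
  have hM' : y - d * M ≤ d := by
    have := (Nat.lt_floor_add_one (y / d)).le
    rw [div_le_iff₀ hd] at this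
    linarith
  have h1 := key M hM
  have h2 : |(y ^ 2 - (d * M) ^ 2) ^ (k + 1) / (2 * (k + 1))| ≤ d * y ^ (2 * k + 1) := by
    have h0 : 0 ≤ y ^ 2 - (d * M) ^ 2 := by
      have : (0 : ℝ) ≤ d * M := by positivity
      nlinarith
    have h4 : y ^ 2 - (d * M) ^ 2 ≤ d * (2 * y) := by
      have : (0 : ℝ) ≤ d * M := by positivity
      have : y ^ 2 - (d * M) ^ 2 = (y - d * M) * (y + d * M) := by ring
      rw [this]
      gcongr
      linarith
    rw [abs_of_nonneg (by positivity), div_le_iff₀ (by positivity), pow_succ']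
    have h3 : (y ^ 2 - (d * M) ^ 2) ^ k ≤ y ^ (2 * k) := by
      rw [pow_mul]
      exact pow_le_pow_left₀ h0 (by nlinarith [sq_nonneg (d * M)]) k
    calc (y ^ 2 - (d * M) ^ 2) * (y ^ 2 - (d * M) ^ 2) ^ k ≤ d * (2 * y) * y ^ (2 * k) := by gcongr
      _ = d * y ^ (2 * k + 1) * 2 := by ring
      _ ≤ d * y ^ (2 * k + 1) * (2 * (k + 1)) := by
        gcongr
        linarith [(Nat.cast_nonneg k : (0 : ℝ) ≤ k)]
  have h3 : M * ((2 * k + 1) * y ^ (2 * k) * d ^ 2) ≤ (2 * k + 1) * d * y ^ (2 * k + 1) := by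
    calc M * ((2 * k + 1) * y ^ (2 * k) * d ^ 2) = (2 * k + 1) * d * y ^ (2 * k) * (d * M) := by ring
      _ ≤ (2 * k + 1) * d * y ^ (2 * k) * y := by gcongr
      _ = _ := by ring
  have h5 := abs_sub_le (∑ m ∈ Finset.Icc 1 M, d * ((d * m) * (y ^ 2 - (d * m) ^ 2) ^ k))
    (y ^ (2 * (k + 1)) / (2 * (k + 1)) - (y ^ 2 - (d * M) ^ 2) ^ (k + 1) / (2 * (k + 1)))
    (y ^ (2 * (k + 1)) / (2 * (k + 1)))
  rw [sub_sub_cancel_left, abs_neg] at h5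
  linarith

/-- Induction on `k`. Fixing the first coordinate `d₀ m` leaves a ball of squared radius `y² - (d₀
m)²`; the inductive main terms form a Riemann sum for `∫ t (y² - t²)^k dt` over `[0, y]`, and the
inductive errors are summed over at most `y / d₀` values of `m`. -/
theorem abs_latticeSum_sub_le_of_sq {k : ℕ} {d : Fin k → ℕ} (hd : ∀ i, 1 ≤ d i) {D : ℝ}
    (hD : ∀ i, (d i : ℝ) ≤ D) {y : ℝ} (hy : 0 ≤ y) :
    |(∏ i, (d i : ℝ)) * latticeSum d (y ^ 2) - y ^ (2 * k) / (2 ^ k * k.factorial)| ≤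
      2 * k * D * y ^ (2 * k - 1) := by
  induction k generalizing y with
  | zero => simp [latticeSum_zero d (sq_nonneg y)]
  | succ k ih =>
    have hd0 : (0 : ℝ) < d 0 := by exact_mod_cast hd 0
    have hD0 : 0 < D := hd0.trans_le (hD 0)
    have hle : ∀ m ∈ Finset.Icc 1 ⌊y / d 0⌋₊, (d 0 : ℝ) * m ≤ y := by
      intro m hm
      have := (Nat.le_floor_iff (by positivity)).1 (Finset.mem_Icc.1 hm).2
      rw [le_div_iff₀ hd0] at this
      linarith
    have hfl : (⌊y / d 0⌋₊ : ℝ) * d 0 ≤ y := by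
      rw [← le_div_iff₀ hd0]
      exact Nat.floor_le (by positivity)
    rw [latticeSum_succ (hd 0), Real.sqrt_sq hy, Fin.prod_univ_succ]
    set P : ℝ := ∏ i : Fin k, (d i.succ : ℝ)
    set c : ℝ := 2 ^ k * k.factorial with hc
    -- Dividing by `c` must absorb the factor `k + 1` of the Riemann sum error, so that each
    -- coordinate adds only `2 D y^(2k+1)`.
    have hc1 : (k : ℝ) + 1 ≤ c := by
      have h1 : k + 1 ≤ 2 ^ k * k.factorial :=
        (Nat.lt_two_pow_self (n := k)).trans_le (Nat.le_mul_of_pos_right _ k.factorial_pos)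
      rw [hc]
      exact_mod_cast h1
    have hc0 : 0 < c := by positivity
    have hR := riemannSum_sub_le hy hd0 k
    set S := ∑ m ∈ Finset.Icc 1 ⌊y / d 0⌋₊,
      (d 0 : ℝ) * ((d 0 * m) * (y ^ 2 - (d 0 * m) ^ 2) ^ k) with hS
    have hterm : ∀ m ∈ Finset.Icc 1 ⌊y / d 0⌋₊,
        |d 0 * P * ((d 0 * m) * latticeSum (Fin.tail d) (y ^ 2 - (d 0 * m) ^ 2)) -
          (d 0 : ℝ) * ((d 0 * m) * (y ^ 2 - (d 0 * m) ^ 2) ^ k) / c| ≤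
        d 0 * (y * (2 * k * D * y ^ (2 * k - 1))) := by
      intro m hm
      have h1 := hle m hm
      have h0 : (0 : ℝ) ≤ d 0 * m := by positivity
      have hz : 0 ≤ y ^ 2 - ((d 0 : ℝ) * m) ^ 2 := by nlinarith
      have h2 := ih (d := Fin.tail d) (fun i => hd _) (fun i => hD _)
        (Real.sqrt_nonneg (y ^ 2 - ((d 0 : ℝ) * m) ^ 2))
      rw [pow_mul, Real.sq_sqrt hz] at h2
      have h3 : √(y ^ 2 - ((d 0 : ℝ) * m) ^ 2) ≤ y :=
        Real.sqrt_le_iff.2 ⟨hy, by nlinarith⟩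
      have h4 : d 0 * P * ((d 0 * m) * latticeSum (Fin.tail d) (y ^ 2 - (d 0 * m) ^ 2)) -
          (d 0 : ℝ) * ((d 0 * m) * (y ^ 2 - (d 0 * m) ^ 2) ^ k) / c =
          d 0 * ((d 0 * m) * (P * latticeSum (Fin.tail d) (y ^ 2 - (d 0 * m) ^ 2) -
            (y ^ 2 - (d 0 * m) ^ 2) ^ k / c)) := by ring
      rw [h4, abs_mul, abs_mul, abs_of_pos hd0, abs_of_nonneg h0]
      gcongr
      refine h2.trans ?_
      gcongr
    have hsum : |d 0 * P * (∑ m ∈ Finset.Icc 1 ⌊y / d 0⌋₊,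
        ((d 0 : ℝ) * m) * latticeSum (Fin.tail d) (y ^ 2 - ((d 0 : ℝ) * m) ^ 2)) - S / c| ≤
        2 * k * D * y ^ (2 * k + 1) := by
      rw [Finset.mul_sum, hS, Finset.sum_div, ← Finset.sum_sub_distrib]
      refine (Finset.abs_sum_le_sum_abs _ _).trans ((Finset.sum_le_sum hterm).trans ?_)
      rw [Finset.sum_const, Nat.card_Icc, Nat.add_sub_cancel, nsmul_eq_mul]
      -- For `k = 0` the exponent `2 * k - 1` truncates to `0`, but the factor `k` makes both sides
      -- vanish.
      rcases Nat.eq_zero_or_pos k with rfl | hk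
      · simp
      · have h5 : y ^ (2 * k + 1) = y * (y * y ^ (2 * k - 1)) := by
          rw [← pow_succ', ← pow_succ']
          congr 1
          omega
        rw [h5]
        calc ⌊y / d 0⌋₊ * (d 0 * (y * (2 * k * D * y ^ (2 * k - 1))))
            = (⌊y / d 0⌋₊ * d 0) * (y * (2 * k * D * y ^ (2 * k - 1))) := by ring
          _ ≤ y * (y * (2 * k * D * y ^ (2 * k - 1))) := by gcongr
          _ = _ := by ring
    have hR' : |S / c - y ^ (2 * (k + 1)) / (2 ^ (k + 1) * (k + 1).factorial)| ≤
        2 * D * y ^ (2 * k + 1) := by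
      have h6 : S / c - y ^ (2 * (k + 1)) / (2 ^ (k + 1) * (k + 1).factorial) =
          (S - y ^ (2 * (k + 1)) / (2 * (k + 1))) / c := by
        rw [hc, Nat.factorial_succ]
        have := k.factorial_ne_zero
        push_cast
        field_simp
        ring
      rw [h6, abs_div, abs_of_pos hc0, div_le_iff₀ hc0]
      refine hR.trans ?_
      calc (2 * k + 2) * d 0 * y ^ (2 * k + 1) = 2 * d 0 * y ^ (2 * k + 1) * (k + 1) := by ring
        _ ≤ 2 * D * y ^ (2 * k + 1) * c := by
          gcongr
          exact hD 0
    have h7 : 2 * (k + 1) - 1 = 2 * k + 1 := by omega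
    rw [h7]
    refine (abs_sub_le _ (S / c) _).trans ((add_le_add hsum hR').trans (le_of_eq ?_))
    push_cast
    ring

/-- The sum over the lattice `∏ dᵢℤ` is `x ^ k / (2 ^ k k! ∏ dᵢ)` up to a relative error
of at most `max dᵢ / √x`. -/
theorem abs_latticeSum_sub_le {k : ℕ} {d : Fin k → ℕ} (hk : 1 ≤ k) (hd : ∀ i, 1 ≤ d i) {D : ℝ}
    (hD : ∀ i, (d i : ℝ) ≤ D) {x : ℝ} (hx : 0 < x) :
    |latticeSum d x - x ^ k / (2 ^ k * k.factorial) / ∏ i, (d i : ℝ)| ≤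
      2 * k * x ^ k * min 1 (D / √x) / ∏ i, (d i : ℝ) := by
  have hP : 0 < ∏ i, (d i : ℝ) := Finset.prod_pos fun i _ => by exact_mod_cast hd i
  have hy : 0 < √x := Real.sqrt_pos.2 hx
  have hyk : √x ^ (2 * k) = x ^ k := by rw [pow_mul, Real.sq_sqrt hx.le]
  have hk' : (1 : ℝ) ≤ k := by exact_mod_cast hk
  rw [le_div_iff₀ hP, ← abs_of_pos hP, ← abs_mul, abs_of_pos hP, sub_mul, div_mul_cancel₀ _ hP.ne',
    mul_comm (latticeSum d x)]
  -- If some `d i` exceeds `√x` the sum is empty, the minimum is `1`, and the main term alone is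
  -- within the bound.
  by_cases hs : ∃ i, √x < d i
  · obtain ⟨i, hi⟩ := hs
    have h1 : 1 ≤ D / √x := by
      rw [le_div_iff₀ hy, one_mul]
      exact hi.le.trans (hD i)
    have hc : (1 : ℝ) ≤ 2 ^ k * k.factorial := by
      exact_mod_cast Nat.mul_pos (by positivity) k.factorial_pos
    rw [latticeSum_eq_zero hi, min_eq_left h1, mul_zero, zero_sub, abs_neg,
      abs_of_nonneg (by positivity), mul_one]
    calc x ^ k / (2 ^ k * k.factorial) ≤ x ^ k := div_le_self (by positivity) hc
      _ ≤ 2 * k * x ^ k := le_mul_of_one_le_left (by positivity) (by linarith)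
  · push Not at hs
    -- Now `√x` bounds every `d i` as well as `D` does, so the previous estimate applies with the
    -- smaller of the two; this produces the minimum in the statement.
    set D' : ℝ := min √x D
    have h := abs_latticeSum_sub_le_of_sq hd (D := D') (fun i => le_min (hs i) (hD i)) hy.le
    rw [Real.sq_sqrt hx.le, hyk] at h
    have h2 : min 1 (D / √x) = D' / √x := by
      rw [← div_self hy.ne', min_div_div_right hy.le]
    rw [h2]
    refine h.trans (le_of_eq ?_)
    rw [← hyk]
    have : √x ^ (2 * k) = √x ^ (2 * k - 1) * √x := by
      rw [← pow_succ]; congr 1; omega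
    rw [this]
    field_simp

/-! ### Möbius inversion in several variables -/

/-- The tuples of divisors of the entries of `n`. -/
def divisorBox {k : ℕ} (n : Fin k → ℕ) : Finset (Fin k → ℕ) :=
  Fintype.piFinset fun i => (n i).divisors

theorem mem_divisorBox {k : ℕ} {n e : Fin k → ℕ} :
    e ∈ divisorBox n ↔ ∀ i, e i ∣ n i ∧ n i ≠ 0 := by
  simp [divisorBox]

/-- The Möbius transform of a function of `k` natural numbers. -/
noncomputable def moebiusTransform {k : ℕ} (F : (Fin k → ℕ) → ℝ) (d : Fin k → ℕ) : ℝ :=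
  ∑ e ∈ divisorBox d, (∏ i, ((ArithmeticFunction.moebius (d i / e i) : ℤ) : ℝ)) * F e

theorem sum_moebius_div_left {n e : ℕ} (hn : n ≠ 0) (he : e ∣ n) :
    ∑ t ∈ n.divisors with e ∣ t, ((ArithmeticFunction.moebius (t / e) : ℤ) : ℝ) =
      if n = e then 1 else 0 := by
  obtain ⟨m, rfl⟩ := he
  have he0 : 0 < e := Nat.pos_of_ne_zero (left_ne_zero_of_mul hn)
  have hm0 : m ≠ 0 := right_ne_zero_of_mul hn
  have h1 : ∑ t ∈ (e * m).divisors with e ∣ t,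
      ((ArithmeticFunction.moebius (t / e) : ℤ) : ℝ) =
      ∑ s ∈ m.divisors, ((ArithmeticFunction.moebius s : ℤ) : ℝ) := by
    refine Finset.sum_nbij' (fun t => t / e) (fun s => e * s) ?_ ?_ ?_ ?_ ?_
    · intro t ht
      obtain ⟨h, s, rfl⟩ := Finset.mem_filter.1 ht
      rw [Nat.mul_div_cancel_left _ he0, Nat.mem_divisors]
      exact ⟨(Nat.mul_dvd_mul_iff_left he0).1 (Nat.dvd_of_mem_divisors h), hm0⟩
    · intro s hs
      rw [Finset.mem_filter, Nat.mem_divisors]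
      exact ⟨⟨Nat.mul_dvd_mul_left e (Nat.dvd_of_mem_divisors hs), hn⟩, dvd_mul_right _ _⟩
    · intro t ht
      exact Nat.mul_div_cancel' (Finset.mem_filter.1 ht).2
    · intro s _
      exact Nat.mul_div_cancel_left _ he0
    · intro t _
      rfl
  have h2 := congrArg (fun f => f m) ArithmeticFunction.moebius_mul_coe_zeta
  rw [ArithmeticFunction.coe_mul_zeta_apply, ArithmeticFunction.one_apply] at h2
  rw [h1, ← Int.cast_sum, h2]
  have : e * m = e ↔ m = 1 := by
    constructor
    · intro h
      exact Nat.eq_of_mul_eq_mul_left he0 (by simpa using h)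
    · rintro rfl
      simp
  simp [this]

/-- The involution `e s ↦ e r` on the multiples of `e` dividing `n = e s r` exchanges `n / t` and `t
/ e`, which reduces this to `sum_moebius_div_left`. -/
theorem sum_moebius_div_right {n e : ℕ} (hn : n ≠ 0) (he : e ∣ n) :
    ∑ t ∈ n.divisors with e ∣ t, ((ArithmeticFunction.moebius (n / t) : ℤ) : ℝ) =
      if n = e then 1 else 0 := by
  rw [← sum_moebius_div_left hn he]
  obtain ⟨m, rfl⟩ := he
  have he0 : 0 < e := Nat.pos_of_ne_zero (left_ne_zero_of_mul hn)
  have key : ∀ t, t ∈ (e * m).divisors → e ∣ t → ∃ s r, t = e * s ∧ m = s * r ∧ s ≠ 0 ∧ r ≠ 0 := by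
    rintro t ht ⟨s, rfl⟩
    obtain ⟨r, hr⟩ := (Nat.mul_dvd_mul_iff_left he0).1 (Nat.dvd_of_mem_divisors ht)
    refine ⟨s, r, rfl, hr, ?_, ?_⟩ <;> rintro rfl <;> simp [hr] at hn
  have h2 : ∀ s r : ℕ, s ≠ 0 → e * (s * r) / (e * s) = r := by
    intro s r hs
    rw [← mul_assoc, Nat.mul_div_cancel_left _ (by positivity)]
  refine Finset.sum_nbij' (fun t => e * (e * m / t)) (fun t => e * (e * m / t)) ?_ ?_ ?_ ?_ ?_
  all_goals
    intro t ht
    rw [Finset.mem_filter] at ht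
    obtain ⟨s, r, rfl, rfl, hs, hr⟩ := key t ht.1 ht.2
    simp only [h2 s r hs]
  · exact Finset.mem_filter.2 ⟨Nat.mem_divisors.2 ⟨mul_dvd_mul_left _ (dvd_mul_left _ _), hn⟩,
      dvd_mul_right _ _⟩
  · exact Finset.mem_filter.2 ⟨Nat.mem_divisors.2 ⟨mul_dvd_mul_left _ (dvd_mul_left _ _), hn⟩,
      dvd_mul_right _ _⟩
  · rw [mul_comm s r, h2 r s hr]
  · rw [mul_comm s r, h2 r s hr]
  · rw [Nat.mul_div_cancel_left _ he0]

/-- The condition `e ∣ d ∣ n` is coordinatewise, so the sum of products is a product of one-variable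
sums. -/
theorem sum_box_filter_prod {k : ℕ} {n e : Fin k → ℕ}
    (φ : ℕ → ℕ → ℕ → ℝ)
    (hφ : ∀ i, ∑ t ∈ (n i).divisors with e i ∣ t, φ (n i) (e i) t = if n i = e i then 1 else 0) :
    ∑ d ∈ divisorBox n with e ∈ divisorBox d, ∏ i, φ (n i) (e i) (d i) =
      if n = e then 1 else 0 := by
  have h1 : (divisorBox n).filter (fun d => e ∈ divisorBox d) =
      Fintype.piFinset fun i => (n i).divisors.filter (e i ∣ ·) := by
    ext d
    simp only [Finset.mem_filter, mem_divisorBox, Fintype.mem_piFinset, Nat.mem_divisors,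
      ← forall_and]
    refine forall_congr' fun i => ⟨fun h => ⟨h.1, h.2.1⟩, fun h => ⟨h.1, h.2, ?_⟩⟩
    exact fun h0 => h.1.2 (Nat.eq_zero_of_zero_dvd (h0 ▸ h.1.1))
  rw [h1, ← Finset.prod_univ_sum, Finset.prod_congr rfl fun i _ => hφ i]
  split_ifs with h
  · simp [h]
  · obtain ⟨i, hi⟩ := Function.ne_iff.1 h
    exact Finset.prod_eq_zero (Finset.mem_univ i) (if_neg hi)

theorem divisorBox_trans {k : ℕ} {n d e : Fin k → ℕ} (hd : d ∈ divisorBox n)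
    (he : e ∈ divisorBox d) : e ∈ divisorBox n := by
  rw [mem_divisorBox] at *
  exact fun i => ⟨(he i).1.trans (hd i).1, (hd i).2⟩

theorem self_mem_divisorBox {k : ℕ} {n : Fin k → ℕ} (hn : ∀ i, n i ≠ 0) : n ∈ divisorBox n :=
  mem_divisorBox.2 fun i => ⟨dvd_rfl, hn i⟩

theorem sum_moebiusTransform {k : ℕ} (F : (Fin k → ℕ) → ℝ) {n : Fin k → ℕ} (hn : ∀ i, n i ≠ 0) :
    ∑ d ∈ divisorBox n, moebiusTransform F d = F n := by
  unfold moebiusTransform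
  rw [Finset.sum_comm' (t' := divisorBox n)
    (s' := fun e => (divisorBox n).filter fun d => e ∈ divisorBox d)]
  · simp_rw [← Finset.sum_mul]
    rw [Finset.sum_eq_single_of_mem n (self_mem_divisorBox hn)]
    · rw [sum_box_filter_prod
        (fun _ e t => ((ArithmeticFunction.moebius (t / e) : ℤ) : ℝ))
        (fun i => sum_moebius_div_left (hn i) dvd_rfl), if_pos rfl, one_mul]
    · intro e he hne
      rw [sum_box_filter_prod
        (fun _ e t => ((ArithmeticFunction.moebius (t / e) : ℤ) : ℝ))
        (fun i => sum_moebius_div_left (hn i) (mem_divisorBox.1 he i).1), if_neg hne.symm, zero_mul]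
  · intro d e
    rw [Finset.mem_filter]
    exact ⟨fun h => ⟨⟨h.1, h.2⟩, divisorBox_trans h.1 h.2⟩, fun h => h.1⟩

/-- Uniqueness in Möbius inversion; it serves to identify the transform explicitly when `k = 2`. -/
theorem moebiusTransform_eq {k : ℕ} {F G : (Fin k → ℕ) → ℝ}
    (h : ∀ n : Fin k → ℕ, (∀ i, n i ≠ 0) → ∑ d ∈ divisorBox n, G d = F n) {n : Fin k → ℕ}
    (hn : ∀ i, n i ≠ 0) : moebiusTransform F n = G n := by
  have h1 : moebiusTransform F n = ∑ d ∈ divisorBox n, ∑ e ∈ divisorBox d,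
      (∏ i, ((ArithmeticFunction.moebius (n i / d i) : ℤ) : ℝ)) * G e := by
    refine Finset.sum_congr rfl fun d hd => ?_
    rw [← Finset.mul_sum, h]
    intro i h0
    exact (mem_divisorBox.1 hd i).2 (Nat.eq_zero_of_zero_dvd (h0 ▸ (mem_divisorBox.1 hd i).1))
  rw [h1, Finset.sum_comm' (t' := divisorBox n)
    (s' := fun e => (divisorBox n).filter fun d => e ∈ divisorBox d)]
  · simp_rw [← Finset.sum_mul]
    rw [Finset.sum_eq_single_of_mem n (self_mem_divisorBox hn)]
    · rw [sum_box_filter_prod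
        (fun n _ t => ((ArithmeticFunction.moebius (n / t) : ℤ) : ℝ))
        (fun i => sum_moebius_div_right (hn i) dvd_rfl), if_pos rfl, one_mul]
    · intro e he hne
      rw [sum_box_filter_prod
        (fun n _ t => ((ArithmeticFunction.moebius (n / t) : ℤ) : ℝ))
        (fun i => sum_moebius_div_right (hn i) (mem_divisorBox.1 he i).1), if_neg hne.symm,
        zero_mul]
  · intro d e
    rw [Finset.mem_filter]
    exact ⟨fun h => ⟨⟨h.1, h.2⟩, divisorBox_trans h.1 h.2⟩, fun h => h.1⟩

theorem moebiusTransform_eq_zero_of_eq_zero {k : ℕ} (F : (Fin k → ℕ) → ℝ) {d : Fin k → ℕ}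
    {i : Fin k} (h : d i = 0) : moebiusTransform F d = 0 := by
  refine Finset.sum_eq_zero fun e he => ?_
  exact absurd h (mem_divisorBox.1 he i).2

/-- By coprimality, a divisor of `a i * b i` is uniquely a product of its gcds with `a i` and `b i`.
-/
theorem sum_divisorBox_mul {k : ℕ} {a b : Fin k → ℕ} (hab : ∀ i, (a i).Coprime (b i))
    (X : (Fin k → ℕ) → ℝ) :
    ∑ e ∈ divisorBox (a * b), X e =
      ∑ u ∈ divisorBox a, ∑ v ∈ divisorBox b, X (u * v) := by
  rw [← Finset.sum_product']
  symm
  refine Finset.sum_nbij' (fun p => p.1 * p.2)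
    (fun e => (fun i => (e i).gcd (a i), fun i => (e i).gcd (b i))) ?_ ?_ ?_ ?_ ?_
  · rintro ⟨u, v⟩ h
    rw [Finset.mem_product, mem_divisorBox, mem_divisorBox] at h
    rw [mem_divisorBox]
    exact fun i => ⟨mul_dvd_mul (h.1 i).1 (h.2 i).1, mul_ne_zero (h.1 i).2 (h.2 i).2⟩
  · intro e he
    rw [mem_divisorBox] at he
    rw [Finset.mem_product, mem_divisorBox, mem_divisorBox]
    exact ⟨fun i => ⟨Nat.gcd_dvd_right _ _, left_ne_zero_of_mul (he i).2⟩,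
      fun i => ⟨Nat.gcd_dvd_right _ _, right_ne_zero_of_mul (he i).2⟩⟩
  · rintro ⟨u, v⟩ h
    rw [Finset.mem_product, mem_divisorBox, mem_divisorBox] at h
    refine Prod.ext (funext fun i => ?_) (funext fun i => ?_)
    · have : (v i).Coprime (a i) := (Nat.Coprime.coprime_dvd_right (h.2 i).1 (hab i)).symm
      simp only [Pi.mul_apply]
      rw [Nat.Coprime.gcd_mul_right_cancel _ this]
      exact Nat.gcd_eq_left (h.1 i).1
    · have : (u i).Coprime (b i) := Nat.Coprime.coprime_dvd_left (h.1 i).1 (hab i)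
      simp only [Pi.mul_apply]
      rw [Nat.Coprime.gcd_mul_left_cancel _ this]
      exact Nat.gcd_eq_left (h.2 i).1
  · intro e he
    rw [mem_divisorBox] at he
    funext i
    simp only [Pi.mul_apply]
    rw [← Nat.Coprime.gcd_mul _ (hab i)]
    exact Nat.gcd_eq_left (he i).1
  · intro p _
    rfl

theorem univ_lcm_mul {k : ℕ} {u v : Fin k → ℕ} {A B : ℕ} (hAB : A.Coprime B) (hu : ∀ i, u i ∣ A)
    (hv : ∀ i, v i ∣ B) :
    Finset.univ.lcm (u * v) = Finset.univ.lcm u * Finset.univ.lcm v := by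
  refine Nat.dvd_antisymm (Finset.lcm_dvd fun i hi => ?_) ?_
  · exact mul_dvd_mul (Finset.dvd_lcm hi) (Finset.dvd_lcm hi)
  · refine Nat.Coprime.mul_dvd_of_dvd_of_dvd ?_ ?_ ?_
    · exact Nat.Coprime.coprime_dvd_left (Finset.lcm_dvd fun i _ => hu i)
        (Nat.Coprime.coprime_dvd_right (Finset.lcm_dvd fun i _ => hv i) hAB)
    · exact Finset.lcm_dvd fun i hi => (dvd_mul_right _ _).trans (Finset.dvd_lcm (f := u * v) hi)
    · exact Finset.lcm_dvd fun i hi => (dvd_mul_left _ _).trans (Finset.dvd_lcm (f := u * v) hi)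

/-! ### The ratio of lcm to product, and its multiplicativity -/

/-- The quotient `[n₁, …, n_k] / (n₁ ⋯ n_k)`. -/
noncomputable def lcmRatio {k : ℕ} (n : Fin k → ℕ) : ℝ :=
  ((Finset.univ.lcm n : ℕ) : ℝ) / ∏ i, (n i : ℝ)

theorem lcmRatio_mul {k : ℕ} {u v : Fin k → ℕ} {A B : ℕ} (hAB : A.Coprime B)
    (hu : ∀ i, u i ∣ A) (hv : ∀ i, v i ∣ B) :
    lcmRatio (u * v) = lcmRatio u * lcmRatio v := by
  simp only [lcmRatio, univ_lcm_mul hAB hu hv, Pi.mul_apply, Nat.cast_mul, Finset.prod_mul_distrib]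
  exact mul_div_mul_comm _ _ _ _

theorem lcmRatio_nonneg {k : ℕ} (n : Fin k → ℕ) : 0 ≤ lcmRatio n := by
  unfold lcmRatio
  positivity

theorem univ_lcm_ne_zero {k : ℕ} {n : Fin k → ℕ} (hn : ∀ i, n i ≠ 0) : Finset.univ.lcm n ≠ 0 := by
  rw [Ne, Finset.lcm_eq_zero_iff]
  simpa using hn

theorem lcmRatio_le_one {k : ℕ} {n : Fin k → ℕ} (hn : ∀ i, n i ≠ 0) : lcmRatio n ≤ 1 := by
  have h0 : 0 < ∏ i, n i := Finset.prod_pos fun i _ => Nat.pos_of_ne_zero (hn i)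
  have h : Finset.univ.lcm n ≤ ∏ i, n i :=
    Nat.le_of_dvd h0 (Finset.lcm_dvd fun i hi => Finset.dvd_prod_of_mem n hi)
  refine div_le_one_of_le₀ ?_ (by positivity)
  exact_mod_cast h

theorem lcmRatio_mul_prod {k : ℕ} {n : Fin k → ℕ} (hn : ∀ i, n i ≠ 0) :
    lcmRatio n * ∏ i, (n i : ℝ) = (Finset.univ.lcm n : ℕ) := by
  have : ∏ i, (n i : ℝ) ≠ 0 := Finset.prod_ne_zero_iff.2 fun i _ => by exact_mod_cast hn i
  exact div_mul_cancel₀ _ this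

theorem moebiusTransform_lcmRatio_mul {k : ℕ} {a b : Fin k → ℕ} {A B : ℕ} (hAB : A.Coprime B)
    (ha : ∀ i, a i ∣ A) (hb : ∀ i, b i ∣ B) :
    moebiusTransform lcmRatio (a * b) = moebiusTransform lcmRatio a * moebiusTransform lcmRatio b := by
  have hab : ∀ i, (a i).Coprime (b i) := fun i =>
    Nat.Coprime.coprime_dvd_left (ha i) (Nat.Coprime.coprime_dvd_right (hb i) hAB)
  unfold moebiusTransform
  rw [sum_divisorBox_mul hab, Finset.sum_mul_sum]
  refine Finset.sum_congr rfl fun u hu => Finset.sum_congr rfl fun v hv => ?_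
  rw [mem_divisorBox] at hu hv
  rw [lcmRatio_mul hAB (fun i => (hu i).1.trans (ha i)) (fun i => (hv i).1.trans (hb i)),
    mul_mul_mul_comm, ← Finset.prod_mul_distrib]
  congr 1
  refine Finset.prod_congr rfl fun i _ => ?_
  rw [Pi.mul_apply, Pi.mul_apply, Nat.mul_div_mul_comm (hu i).1 (hv i).1,
    ArithmeticFunction.isMultiplicative_moebius.map_mul_of_coprime, Int.cast_mul]
  exact Nat.Coprime.coprime_dvd_left (Nat.div_dvd_of_dvd (hu i).1)
    (Nat.Coprime.coprime_dvd_right (Nat.div_dvd_of_dvd (hv i).1) (hab i))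

/-- Each term is at most `1` in absolute value, so it is enough to count the tuples of divisors. -/
theorem abs_moebiusTransform_lcmRatio_le {k : ℕ} {d : Fin k → ℕ} {L : ℕ} (hL : L ≠ 0)
    (hd : ∀ i, d i ∣ L) : |moebiusTransform lcmRatio d| ≤ (L.divisors.card : ℝ) ^ k := by
  refine (Finset.abs_sum_le_sum_abs _ _).trans ?_
  have h1 : ∀ e ∈ divisorBox d,
      |(∏ i, ((ArithmeticFunction.moebius (d i / e i) : ℤ) : ℝ)) * lcmRatio e| ≤ 1 := by
    intro e he
    rw [mem_divisorBox] at he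
    rw [abs_mul, Finset.abs_prod, abs_of_nonneg (lcmRatio_nonneg e)]
    refine mul_le_one₀ (Finset.prod_le_one (fun _ _ => abs_nonneg _) fun i _ => ?_)
      (lcmRatio_nonneg e) (lcmRatio_le_one fun i h0 => (he i).2 ?_)
    · exact_mod_cast ArithmeticFunction.abs_moebius_le_one
    · exact Nat.eq_zero_of_zero_dvd (h0 ▸ (he i).1)
  refine (Finset.sum_le_card_nsmul _ _ _ h1).trans ?_
  rw [nsmul_one, divisorBox, Fintype.card_piFinset]
  have h2 : ∏ i, (d i).divisors.card ≤ ∏ _i : Fin k, L.divisors.card :=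
    Finset.prod_le_prod' fun i _ => Finset.card_le_card (Nat.divisors_subset_of_dvd hL (hd i))
  rw [Finset.prod_const, Finset.card_univ, Fintype.card_fin] at h2
  exact_mod_cast h2

/-! ### The support of the Möbius transform -/

/-- The Möbius transform of `1 / n`. -/
noncomputable def invMoebius (n : ℕ) : ℝ :=
  ∑ x ∈ n.divisorsAntidiagonal, ((ArithmeticFunction.moebius x.1 : ℤ) : ℝ) * (1 / (x.2 : ℝ))

theorem sum_divisors_invMoebius {n : ℕ} (hn : n ≠ 0) : ∑ c ∈ n.divisors, invMoebius c = 1 / n :=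
  (ArithmeticFunction.sum_eq_iff_sum_mul_moebius_eq (f := invMoebius)
    (g := fun n => 1 / (n : ℝ))).2 (fun _ _ => rfl) n (Nat.pos_of_ne_zero hn)

/-- `1 / gcd(t, M)` is the sum of `invMoebius c` over those divisors `c` of `t` that also divide
`M`. Its Möbius transform is therefore supported on the divisors of `M`. -/
theorem sum_moebius_div_gcd_eq_zero {D M : ℕ} (hD : D ≠ 0) (h : ¬ D ∣ M) :
    ∑ t ∈ D.divisors, ((ArithmeticFunction.moebius (D / t) : ℤ) : ℝ) * (1 / (t.gcd M : ℝ)) = 0 := by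
  have h1 : ∀ n > 0, ∑ c ∈ n.divisors, (if c ∣ M then invMoebius c else 0) =
      1 / (n.gcd M : ℝ) := by
    intro n hn
    rw [← sum_divisors_invMoebius (Nat.gcd_pos_of_pos_left M hn).ne', ← Finset.sum_filter]
    refine Finset.sum_congr ?_ fun _ _ => rfl
    ext c
    simp only [Finset.mem_filter, Nat.mem_divisors, Nat.dvd_gcd_iff]
    have h2 := (Nat.gcd_pos_of_pos_left M hn).ne'
    have h3 := hn.ne'
    tauto
  have h2 := ArithmeticFunction.sum_eq_iff_sum_mul_moebius_eq.1 h1 D (Nat.pos_of_ne_zero hD)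
  rw [if_neg h, Nat.sum_divisorsAntidiagonal'
    (f := fun a b => ((ArithmeticFunction.moebius a : ℤ) : ℝ) * (1 / (b.gcd M : ℝ)))] at h2
  exact h2

theorem univ_lcm_insertNth {k : ℕ} (i : Fin (k + 1)) (t : ℕ) (e : Fin k → ℕ) :
    Finset.univ.lcm (i.insertNth t e : Fin (k + 1) → ℕ) = t.lcm (Finset.univ.lcm e) := by
  refine Nat.dvd_antisymm (Finset.lcm_dvd fun j _ => ?_) (Nat.lcm_dvd ?_ (Finset.lcm_dvd fun j _ => ?_))
  · refine Fin.succAboveCases i ?_ (fun j => ?_) j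
    · simpa using Nat.dvd_lcm_left _ _
    · simpa using (Finset.dvd_lcm (Finset.mem_univ j)).trans (Nat.dvd_lcm_right _ _)
  · simpa using Finset.dvd_lcm (f := (i.insertNth t e : Fin (k + 1) → ℕ)) (Finset.mem_univ i)
  · simpa using Finset.dvd_lcm (f := (i.insertNth t e : Fin (k + 1) → ℕ))
      (Finset.mem_univ (i.succAbove j))

theorem sum_divisorBox_insertNth {k : ℕ} (i : Fin (k + 1)) (d : Fin (k + 1) → ℕ)
    (X : (Fin (k + 1) → ℕ) → ℝ) :
    ∑ e ∈ divisorBox d, X e =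
      ∑ e ∈ divisorBox (i.removeNth d), ∑ t ∈ (d i).divisors, X (i.insertNth t e) := by
  rw [← Finset.sum_product']
  refine Finset.sum_nbij' (fun e => (i.removeNth e, e i)) (fun p => i.insertNth p.2 p.1)
    ?_ ?_ ?_ ?_ ?_
  · intro e he
    rw [mem_divisorBox] at he
    rw [Finset.mem_product, mem_divisorBox, Nat.mem_divisors]
    exact ⟨fun j => he _, he i⟩
  · rintro ⟨e, t⟩ h
    rw [Finset.mem_product, mem_divisorBox, Nat.mem_divisors] at h
    rw [mem_divisorBox]
    intro j
    refine Fin.succAboveCases i ?_ (fun j => ?_) j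
    · simpa using h.2
    · simpa [Fin.removeNth] using h.1 j
  · intro e _
    simp
  · rintro ⟨e, t⟩ _
    simp
  · intro e _
    simp

/-- Let `M` be the lcm of the entries `e` of a divisor tuple other than the `i`-th, `t`. Since `[t,
M] = t M / gcd(t, M)`, the ratio depends on `t` only through `1 / gcd(t, M)`. If `d i` does not
divide the lcm of the other `d j`, it does not divide `M`, and the inner sum over `t` vanishes for
every `e`. -/
theorem dvd_lcm_removeNth {k : ℕ} {d : Fin (k + 1) → ℕ} (h : moebiusTransform lcmRatio d ≠ 0)
    (i : Fin (k + 1)) : d i ∣ Finset.univ.lcm (i.removeNth d) := by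
  by_contra hdvd
  have hi : d i ≠ 0 := fun h0 => h (moebiusTransform_eq_zero_of_eq_zero _ h0)
  refine h ?_
  rw [moebiusTransform, sum_divisorBox_insertNth i]
  refine Finset.sum_eq_zero fun e he => ?_
  set M := Finset.univ.lcm e
  have hM : ¬ d i ∣ M := fun h' => hdvd (h'.trans (Finset.lcm_dvd fun j hj =>
    ((mem_divisorBox.1 he j).1.trans (Finset.dvd_lcm hj))))
  have h0 := sum_moebius_div_gcd_eq_zero hi hM
  have h1 : ∀ t ∈ (d i).divisors,
      (∏ j, ((ArithmeticFunction.moebius (d j / (i.insertNth t e : Fin (k + 1) → ℕ) j) : ℤ) : ℝ)) *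
        lcmRatio (i.insertNth t e : Fin (k + 1) → ℕ) =
      (((ArithmeticFunction.moebius (d i / t) : ℤ) : ℝ) * (1 / (t.gcd M : ℝ))) *
        ((∏ j, ((ArithmeticFunction.moebius (d (i.succAbove j) / e j) : ℤ) : ℝ)) *
          (M / ∏ j, (e j : ℝ))) := by
    intro t ht
    have ht0 : t ≠ 0 := (Nat.pos_of_mem_divisors ht).ne'
    have hg : (t.gcd M : ℝ) ≠ 0 := by exact_mod_cast (Nat.gcd_pos_of_pos_left M (Nat.pos_of_ne_zero ht0)).ne'
    have hgl : (t.gcd M : ℝ) * (t.lcm M : ℝ) = t * M := by exact_mod_cast Nat.gcd_mul_lcm t M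
    have hlcm : (t.lcm M : ℝ) = t * M / t.gcd M := by
      rw [← hgl]; field_simp
    rw [lcmRatio, univ_lcm_insertNth, Fin.prod_univ_succAbove _ i, Fin.prod_univ_succAbove _ i]
    simp only [Fin.insertNth_apply_same, Fin.insertNth_apply_succAbove]
    rw [hlcm]
    have : (t : ℝ) ≠ 0 := by exact_mod_cast ht0
    field_simp
  rw [Finset.sum_congr rfl h1, ← Finset.sum_mul, h0, zero_mul]

theorem exists_pow_dvd_of_pow_dvd_lcm {ι : Type*} {s : Finset ι} {f : ι → ℕ} {p a : ℕ}
    (hp : p.Prime) (h : p ^ (a + 1) ∣ s.lcm f) (hf : ∀ i ∈ s, f i ≠ 0) :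
    ∃ i ∈ s, p ^ (a + 1) ∣ f i := by
  classical
  induction s using Finset.induction_on with
  | empty =>
    rw [Finset.lcm_empty] at h
    exact absurd (Nat.dvd_one.1 ((dvd_pow_self p (Nat.succ_ne_zero a)).trans h)) hp.ne_one
  | insert i s hi ih =>
    rw [Finset.lcm_insert] at h
    have h0 : s.lcm f ≠ 0 := by
      rw [Ne, Finset.lcm_eq_zero_iff]
      rintro ⟨j, hj, hj0⟩
      exact hf j (Finset.mem_insert_of_mem hj) hj0
    have hi0 := hf i (Finset.mem_insert_self i s)
    have h' : p ^ (a + 1) ∣ Nat.lcm (f i) (s.lcm f) := h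
    rw [hp.pow_dvd_iff_le_factorization (Nat.lcm_ne_zero hi0 h0), Nat.factorization_lcm hi0 h0,
      Finsupp.sup_apply, le_sup_iff, ← hp.pow_dvd_iff_le_factorization hi0,
      ← hp.pow_dvd_iff_le_factorization h0] at h'
    rcases h' with h' | h'
    · exact ⟨i, Finset.mem_insert_self i s, h'⟩
    · obtain ⟨j, hj, hj'⟩ := ih h' fun j hj => hf j (Finset.mem_insert_of_mem hj)
      exact ⟨j, Finset.mem_insert_of_mem hj, hj'⟩

/-- The full power of a prime in the lcm divides some `d i`, hence the lcm of the other entries,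
hence a second entry `d j`: it occurs at least twice in the product. -/
theorem lcm_sq_dvd_prod {k : ℕ} {d : Fin (k + 1) → ℕ} (h : moebiusTransform lcmRatio d ≠ 0) :
    (Finset.univ.lcm d) ^ 2 ∣ ∏ i, d i := by
  have hd : ∀ i, d i ≠ 0 := fun i h0 => h (moebiusTransform_eq_zero_of_eq_zero _ h0)
  have hL := univ_lcm_ne_zero hd
  have hP : ∏ i, d i ≠ 0 := Finset.prod_ne_zero_iff.2 fun i _ => hd i
  rw [← Nat.factorization_prime_le_iff_dvd (pow_ne_zero 2 hL) hP]
  intro p hp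
  rw [Nat.factorization_pow, Finsupp.smul_apply, smul_eq_mul,
    ← hp.pow_dvd_iff_le_factorization hP]
  rcases ha : (Finset.univ.lcm d).factorization p with _ | a
  · simp
  · obtain ⟨i, -, hi⟩ := exists_pow_dvd_of_pow_dvd_lcm hp
      ((hp.pow_dvd_iff_le_factorization hL).2 ha.ge) fun i _ => hd i
    obtain ⟨j, -, hj⟩ := exists_pow_dvd_of_pow_dvd_lcm hp
      (hi.trans (dvd_lcm_removeNth h i)) fun j _ => hd _
    rw [two_mul, pow_add, Fin.prod_univ_succAbove _ i]
    exact mul_dvd_mul hi (hj.trans (Finset.dvd_prod_of_mem (fun j => d (i.succAbove j))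
      (Finset.mem_univ j)))

/-! ### Absolute convergence of the weighted sum -/

/-- Induction on `m`. Since `τ(ab) ≤ τ(a) τ(b)`, the double series of `τ(ab)^m (ab)^p` is dominated
by the square of the series for `m`; grouping the pairs by `n = ab` gains one factor `τ(n)`. -/
theorem summable_card_divisors_pow_mul_rpow {p : ℝ} (hp : p < -1) (m : ℕ) :
    Summable fun n : ℕ => (n.divisors.card : ℝ) ^ m * (n : ℝ) ^ p := by
  induction m with
  | zero => simpa using Real.summable_nat_rpow.2 hp
  | succ m ih =>
    have h1 := ih.mul_of_nonneg ih (fun n => by positivity) (fun n => by positivity)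
    have h2 : Summable fun x : ℕ × ℕ =>
        ((x.1 * x.2).divisors.card : ℝ) ^ m * ((x.1 * x.2 : ℕ) : ℝ) ^ p := by
      refine Summable.of_nonneg_of_le (fun x => by positivity) (fun x => ?_) h1
      have h3 : (x.1 * x.2).divisors.card ≤ x.1.divisors.card * x.2.divisors.card := by
        rw [Nat.divisors_mul]
        exact Finset.card_mul_le
      have h3' : ((x.1 * x.2).divisors.card : ℝ) ≤ x.1.divisors.card * x.2.divisors.card := by
        exact_mod_cast h3
      rw [mul_mul_mul_comm, ← mul_pow, Nat.cast_mul,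
        Real.mul_rpow (Nat.cast_nonneg _) (Nat.cast_nonneg _)]
      gcongr
    have hinj : Function.Injective
        fun x : (Σ n : ℕ, n.divisorsAntidiagonal) => (x.2 : ℕ × ℕ) := by
      rintro ⟨n, x, hx⟩ ⟨n', x', hx'⟩ h
      simp only at h
      subst h
      obtain rfl : n = n' := by
        rw [← (Nat.mem_divisorsAntidiagonal.1 hx).1, ← (Nat.mem_divisorsAntidiagonal.1 hx').1]
      rfl
    have h4 := (h2.comp_injective hinj).sigma
    refine h4.congr fun n => ?_
    have h5 : ∀ x : n.divisorsAntidiagonal, x.1.1 * x.1.2 = n := fun x =>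
      (Nat.mem_divisorsAntidiagonal.1 x.2).1
    simp only [Function.comp_apply, h5]
    rw [tsum_fintype, Finset.sum_const, Finset.card_univ, Fintype.card_coe, nsmul_eq_mul, pow_succ',
      mul_assoc, ← Nat.map_div_right_divisors, Finset.card_map]

/-- The weight `g(d) / (d₁ ⋯ d_k)`, where `g` is the Möbius transform of `lcmRatio`. -/
noncomputable def lcmWeight {k : ℕ} (d : Fin k → ℕ) : ℝ :=
  moebiusTransform lcmRatio d / ∏ i, (d i : ℝ)

theorem lcmWeight_eq_zero {k : ℕ} {d : Fin k → ℕ} {i : Fin k} (h : d i = 0) : lcmWeight d = 0 := by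
  rw [lcmWeight, moebiusTransform_eq_zero_of_eq_zero _ h, zero_div]

theorem abs_lcmWeight_mul_le {k : ℕ} (d : Fin (k + 1) → ℕ) :
    |lcmWeight d| * ((Finset.univ.lcm d : ℕ) : ℝ) ^ (1 / 2 : ℝ) ≤
      ((Finset.univ.lcm d).divisors.card : ℝ) ^ (k + 1) *
        ((Finset.univ.lcm d : ℕ) : ℝ) ^ (-(3 / 2) : ℝ) := by
  by_cases h : moebiusTransform lcmRatio d = 0
  · rw [lcmWeight, h, zero_div, abs_zero, zero_mul]
    positivity
  have hd : ∀ i, d i ≠ 0 := fun i h0 => h (moebiusTransform_eq_zero_of_eq_zero _ h0)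
  have hL := univ_lcm_ne_zero hd
  set L := Finset.univ.lcm d
  have hL' : (0 : ℝ) < L := by exact_mod_cast Nat.pos_of_ne_zero hL
  have hP : 0 < ∏ i, d i := Finset.prod_pos fun i _ => Nat.pos_of_ne_zero (hd i)
  have h1 : (L : ℝ) ^ 2 ≤ ∏ i, (d i : ℝ) := by exact_mod_cast Nat.le_of_dvd hP (lcm_sq_dvd_prod h)
  have h2 := abs_moebiusTransform_lcmRatio_le hL fun i =>
    Finset.dvd_lcm (f := d) (Finset.mem_univ i)
  have h3 : (L : ℝ) ^ (-(3 / 2) : ℝ) = (L : ℝ) ^ (1 / 2 : ℝ) / (L : ℝ) ^ 2 := by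
    rw [← Real.rpow_natCast, ← Real.rpow_sub hL']
    norm_num
  rw [lcmWeight, abs_div, abs_of_pos ((by positivity : (0 : ℝ) < (L : ℝ) ^ 2).trans_le h1), h3,
    div_mul_eq_mul_div, ← mul_div_assoc]
  gcongr

/-- Group by the lcm `L`: at most `τ(L)^(k+1)` tuples share it, each contributing at most
`τ(L)^(k+1) L^(-3/2)`. The weight `L^(1/2)` is what later yields the saving `x^(-1/4)`. -/
theorem summable_abs_lcmWeight_mul {k : ℕ} :
    Summable fun d : Fin (k + 1) → ℕ =>
      |lcmWeight d| * ((Finset.univ.lcm d : ℕ) : ℝ) ^ (1 / 2 : ℝ) := by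
  have hs := summable_card_divisors_pow_mul_rpow (p := -(3 / 2)) (by norm_num) (2 * (k + 1))
  refine summable_of_sum_le (fun d => by positivity) (c := ∑' n : ℕ,
    (n.divisors.card : ℝ) ^ (2 * (k + 1)) * (n : ℝ) ^ (-(3 / 2) : ℝ)) fun s => ?_
  classical
  rw [← Finset.sum_fiberwise_of_maps_to (t := s.image fun d => Finset.univ.lcm d)
    fun d hd => Finset.mem_image_of_mem _ hd]
  refine le_trans (Finset.sum_le_sum fun L _ => ?_) (hs.sum_le_tsum _ fun n _ => by positivity)
  rcases Nat.eq_zero_or_pos L with rfl | hL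
  · refine (Finset.sum_nonpos fun d hd => ?_).trans (by positivity)
    rw [(Finset.mem_filter.1 hd).2]
    norm_num
  · have h1 : ∀ d ∈ s.filter fun d => Finset.univ.lcm d = L,
        |lcmWeight d| * ((Finset.univ.lcm d : ℕ) : ℝ) ^ (1 / 2 : ℝ) ≤
          (L.divisors.card : ℝ) ^ (k + 1) * (L : ℝ) ^ (-(3 / 2) : ℝ) := by
      intro d hd
      have := abs_lcmWeight_mul_le d
      rwa [(Finset.mem_filter.1 hd).2] at this ⊢
    have h2 : (s.filter fun d => Finset.univ.lcm d = L).card ≤ L.divisors.card ^ (k + 1) := by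
      have h3 : (s.filter fun d => Finset.univ.lcm d = L) ⊆ divisorBox fun _ => L := by
        intro d hd
        rw [mem_divisorBox]
        refine fun i => ⟨?_, hL.ne'⟩
        rw [← (Finset.mem_filter.1 hd).2]
        exact Finset.dvd_lcm (Finset.mem_univ i)
      refine (Finset.card_le_card h3).trans (le_of_eq ?_)
      rw [divisorBox, Fintype.card_piFinset, Finset.prod_const, Finset.card_univ, Fintype.card_fin]
    have h2' : ((s.filter fun d => Finset.univ.lcm d = L).card : ℝ) ≤
      (L.divisors.card : ℝ) ^ (k + 1) := by exact_mod_cast h2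
    refine (Finset.sum_le_card_nsmul _ _ _ h1).trans ?_
    rw [nsmul_eq_mul, two_mul (k + 1), pow_add _ (k + 1) (k + 1), mul_assoc]
    gcongr

theorem summable_lcmWeight {k : ℕ} : Summable fun d : Fin (k + 1) → ℕ => lcmWeight d := by
  refine Summable.of_norm_bounded summable_abs_lcmWeight_mul fun d => ?_
  rw [Real.norm_eq_abs]
  by_cases h : ∃ i, d i = 0
  · obtain ⟨i, hi⟩ := h
    simp [lcmWeight_eq_zero hi]
  · push Not at h
    refine le_mul_of_one_le_right (abs_nonneg _) (Real.one_le_rpow ?_ (by norm_num))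
    exact_mod_cast Nat.one_le_iff_ne_zero.2 (univ_lcm_ne_zero h)

theorem lcmWeight_mul {k : ℕ} {a b : Fin k → ℕ} {A B : ℕ} (hAB : A.Coprime B)
    (ha : ∀ i, a i ∣ A) (hb : ∀ i, b i ∣ B) :
    lcmWeight (a * b) = lcmWeight a * lcmWeight b := by
  simp only [lcmWeight, moebiusTransform_lcmRatio_mul hAB ha hb, Pi.mul_apply, Nat.cast_mul,
    Finset.prod_mul_distrib]
  exact mul_div_mul_comm _ _ _ _

/-! ### The Euler product for `C_k` -/

/-- The sum of `W` over the tuples with least common multiple `L`. -/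
def lcmFiberSum {k : ℕ} (W : (Fin k → ℕ) → ℝ) (L : ℕ) : ℝ :=
  ∑ d ∈ divisorBox (fun _ => L) with Finset.univ.lcm d = L, W d

/-- Tuples with lcm `L ≥ 1` all lie in the finite divisor box of `L`; by `h0`, tuples with lcm `0`
carry no weight. -/
theorem hasSum_lcmFiberSum {k : ℕ} {W : (Fin (k + 1) → ℕ) → ℝ} (h0 : ∀ d i, d i = 0 → W d = 0)
    {a : ℝ} (h : HasSum W a) : HasSum (lcmFiberSum W) a := by
  refine (h.tsum_fiberwise fun d => Finset.univ.lcm d).congr_fun fun L => ?_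
  rw [tsum_subtype ((fun d : Fin (k + 1) → ℕ => Finset.univ.lcm d) ⁻¹' {L}) W,
    tsum_eq_sum (s := (divisorBox fun _ => L).filter fun d => Finset.univ.lcm d = L)]
  · refine Finset.sum_congr rfl fun d hd => (Set.indicator_of_mem ?_ _).symm
    exact (Finset.mem_filter.1 hd).2
  · intro d hd
    rw [Set.indicator_apply_eq_zero]
    rintro rfl
    by_contra hW
    have hne : ∀ i, d i ≠ 0 := fun i hi => hW (h0 d i hi)
    refine hd (Finset.mem_filter.2 ⟨mem_divisorBox.2 fun i => ⟨?_, univ_lcm_ne_zero hne⟩, rfl⟩)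
    exact Finset.dvd_lcm (Finset.mem_univ i)

theorem lcmFiberSum_zero {k : ℕ} (W : (Fin (k + 1) → ℕ) → ℝ) : lcmFiberSum W 0 = 0 := by
  refine Finset.sum_eq_zero fun d hd => ?_
  exact absurd rfl (mem_divisorBox.1 (Finset.mem_filter.1 hd).1 0).2

theorem univ_lcm_one {k : ℕ} : Finset.univ.lcm (fun _ : Fin k => 1) = 1 :=
  Nat.dvd_one.1 (Finset.lcm_dvd fun _ _ => dvd_rfl)

theorem lcmWeight_one {k : ℕ} : lcmWeight (fun _ : Fin k => 1) = 1 := by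
  simp [univ_lcm_one, lcmWeight, moebiusTransform, divisorBox, lcmRatio, Fintype.piFinset_singleton]

theorem lcmFiberSum_lcmWeight_one {k : ℕ} : lcmFiberSum (k := k) lcmWeight 1 = 1 := by
  simp [lcmFiberSum, divisorBox, Fintype.piFinset_singleton, Finset.filter_singleton, univ_lcm_one,
    lcmWeight_one]

/-- A tuple of divisors of `A B` splits uniquely as `u v`. As `[u] ∣ A` and `[v] ∣ B`, the product
`[u] [v]` equals `A B` only if `[u] = A` and `[v] = B`. -/
theorem lcmFiberSum_lcmWeight_mul {k : ℕ} {A B : ℕ} (hAB : A.Coprime B) :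
    lcmFiberSum (k := k) lcmWeight (A * B) = lcmFiberSum (k := k) lcmWeight A * lcmFiberSum (k := k) lcmWeight B := by
  have h1 : (fun _ : Fin k => A * B) = (fun _ => A) * (fun _ => B) := rfl
  unfold lcmFiberSum
  rw [Finset.sum_filter, h1, sum_divisorBox_mul fun _ => hAB, Finset.sum_filter, Finset.sum_filter,
    Finset.sum_mul_sum]
  refine Finset.sum_congr rfl fun u hu => Finset.sum_congr rfl fun v hv => ?_
  rw [mem_divisorBox] at hu hv
  have hu' := fun i => (hu i).1
  have hv' := fun i => (hv i).1
  rw [univ_lcm_mul hAB hu' hv', lcmWeight_mul hAB hu' hv']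
  have hA : Finset.univ.lcm u ∣ A := Finset.lcm_dvd fun i _ => hu' i
  have hB : Finset.univ.lcm v ∣ B := Finset.lcm_dvd fun i _ => hv' i
  have hiff : Finset.univ.lcm u * Finset.univ.lcm v = A * B ↔
      Finset.univ.lcm u = A ∧ Finset.univ.lcm v = B := by
    refine ⟨fun h => ⟨Nat.dvd_antisymm hA ?_, Nat.dvd_antisymm hB ?_⟩, fun h => by rw [h.1, h.2]⟩
    · exact (Nat.Coprime.coprime_dvd_right hB hAB).dvd_of_dvd_mul_right (h ▸ dvd_mul_right A B)
    · exact (Nat.Coprime.coprime_dvd_left hA hAB).symm.dvd_of_dvd_mul_left (h ▸ dvd_mul_left B A)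
  simp only [hiff, ite_and]
  by_cases h2 : Finset.univ.lcm u = A
  · rw [if_pos h2, if_pos h2, mul_ite, mul_zero]
  · rw [if_neg h2, if_neg h2, zero_mul]

theorem univ_lcm_prime_pow {k : ℕ} (p : ℕ) (ν : Fin (k + 1) → ℕ) :
    Finset.univ.lcm (fun i => p ^ ν i) = p ^ Finset.univ.sup ν := by
  refine Nat.dvd_antisymm (Finset.lcm_dvd fun i hi => pow_dvd_pow p (Finset.le_sup hi)) ?_
  obtain ⟨i, hi, h⟩ := Finset.exists_mem_eq_sup Finset.univ Finset.univ_nonempty ν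
  rw [h]
  exact Finset.dvd_lcm (f := fun i => p ^ ν i) hi

theorem injective_prime_pow {k : ℕ} {p : ℕ} (hp : p.Prime) :
    Function.Injective fun (ν : Fin k → ℕ) (i : Fin k) => p ^ ν i := by
  intro ν ν' h
  funext i
  exact Nat.pow_right_injective hp.two_le (congrFun h i)

theorem hasSum_lcmFiberSum_prime_pow {k : ℕ} {p : ℕ} (hp : p.Prime) :
    HasSum (fun e => lcmFiberSum (k := k + 1) lcmWeight (p ^ e))
      (∑' ν : Fin (k + 1) → ℕ, lcmWeight fun i => p ^ ν i) := by
  classical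
  set g : (Fin (k + 1) → ℕ) → (Fin (k + 1) → ℕ) := fun ν i => p ^ ν i with hg
  have hinj : Function.Injective g := injective_prime_pow hp
  have h1 : HasSum ((Set.range g).indicator lcmWeight) (∑' ν, lcmWeight (g ν)) := by
    rw [← hasSum_subtype_iff_indicator]
    exact hinj.hasSum_range_iff.2 (summable_lcmWeight.comp_injective hinj).hasSum
  -- The weight is cut down to tuples of powers of `p`. Its fiber sums vanish unless `L` is a power
  -- of `p`, where they agree with those of the full weight.
  have h2 := hasSum_lcmFiberSum (fun d i hi => by
    rw [Set.indicator_apply, lcmWeight_eq_zero hi, ite_self]) h1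
  rw [← (Nat.pow_right_injective hp.two_le).hasSum_iff (f := lcmFiberSum _)] at h2
  · refine h2.congr_fun fun e => Finset.sum_congr rfl fun d hd => ?_
    refine (Set.indicator_of_mem ?_ _).symm
    have h3 : ∀ i, ∃ a, d i = p ^ a := fun i => by
      obtain ⟨a, -, ha⟩ := (Nat.dvd_prime_pow hp).1
        (mem_divisorBox.1 (Finset.mem_filter.1 hd).1 i).1
      exact ⟨a, ha⟩
    choose ν hν using h3
    exact ⟨ν, funext fun i => (hν i).symm⟩
  · intro L hL
    refine Finset.sum_eq_zero fun d hd => Set.indicator_of_notMem ?_ _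
    rintro ⟨ν, rfl⟩
    refine hL ⟨Finset.univ.sup ν, ?_⟩
    rw [← (Finset.mem_filter.1 hd).2]
    exact (univ_lcm_prime_pow p ν).symm

theorem hasSum_pi_geometric {y : ℝ} (hy0 : 0 ≤ y) (hy1 : y < 1) (k : ℕ) :
    HasSum (fun ν : Fin k → ℕ => y ^ ∑ i, ν i) (((1 - y) ^ k)⁻¹) := by
  induction k with
  | zero =>
    convert hasSum_unique (fun ν : Fin 0 → ℕ => y ^ ∑ i, ν i)
    simp
  | succ k ih =>
    have h1 := hasSum_geometric_of_lt_one hy0 hy1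
    have hn1 : ∀ n : ℕ, 0 ≤ y ^ n := fun n => pow_nonneg hy0 n
    have hs := Summable.mul_of_nonneg h1.summable ih.summable hn1 fun ν => hn1 _
    have h2 := HasSum.mul h1 ih hs
    rw [pow_succ', mul_inv]
    refine (Equiv.hasSum_iff (Fin.consEquiv fun _ : Fin (k + 1) => ℕ)).1 ?_
    refine h2.congr_fun fun x => ?_
    rw [Function.comp_apply, Fin.sum_univ_succ, pow_add]
    rfl

theorem sum_divisorBox_prime_pow {k : ℕ} {p : ℕ} (hp : p.Prime) (ν : Fin k → ℕ)
    [Finset.HasAntidiagonal (Fin k → ℕ)] (X : (Fin k → ℕ) → ℝ) :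
    ∑ d ∈ divisorBox (fun i => p ^ ν i), X d =
      ∑ x ∈ Finset.HasAntidiagonal.antidiagonal ν, X fun i => p ^ x.1 i := by
  symm
  refine Finset.sum_nbij (fun x i => p ^ x.1 i) ?_ ?_ ?_ fun _ _ => rfl
  · intro x hx
    rw [Finset.HasAntidiagonal.mem_antidiagonal] at hx
    rw [mem_divisorBox]
    refine fun i => ⟨pow_dvd_pow p ?_, pow_ne_zero _ hp.ne_zero⟩
    rw [← hx]
    exact Nat.le_add_right _ _
  · rintro ⟨a, b⟩ hx ⟨a', b'⟩ hx' h
    rw [Finset.mem_coe, Finset.HasAntidiagonal.mem_antidiagonal] at hx hx'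
    have h1 : a = a' := injective_prime_pow hp h
    subst h1
    simp only at hx hx'
    rw [← hx'] at hx
    rw [add_left_cancel hx]
  · intro d hd
    rw [Finset.mem_coe, mem_divisorBox] at hd
    have h3 : ∀ i, ∃ a ≤ ν i, d i = p ^ a := fun i => (Nat.dvd_prime_pow hp).1 (hd i).1
    choose μ hμ hd' using h3
    refine ⟨(μ, ν - μ), ?_, funext fun i => (hd' i).symm⟩
    rw [Finset.mem_coe, Finset.HasAntidiagonal.mem_antidiagonal]
    exact funext fun i => Nat.add_sub_cancel' (hμ i)

theorem eulerTerm_eq {k : ℕ} (p : Nat.Primes) (ν : Fin (k + 1) → ℕ) :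
    eulerTerm (k + 1) p ν =
      lcmRatio (fun i => (p : ℕ) ^ ν i) * (1 / ((p : ℕ) : ℝ)) ^ ∑ i, ν i := by
  have hp : ((p : ℕ) : ℝ) ≠ 0 := by exact_mod_cast p.2.ne_zero
  have h1 : ∏ i, (((p : ℕ) ^ ν i : ℕ) : ℝ) = ((p : ℕ) : ℝ) ^ ∑ i, ν i := by
    push_cast
    rw [Finset.prod_pow_eq_pow_sum]
  have h2 : 2 * ∑ i, (ν i : ℤ) = ((∑ i, ν i + ∑ i, ν i : ℕ) : ℤ) := by
    push_cast
    ring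
  rw [lcmRatio, univ_lcm_prime_pow, h1, eulerTerm, h2, zpow_sub₀ hp, zpow_natCast, zpow_natCast,
    pow_add, Nat.cast_pow, one_div_pow]
  field_simp

theorem one_div_prime_lt_one (p : Nat.Primes) : 1 / ((p : ℕ) : ℝ) < 1 := by
  have : (1 : ℝ) < (p : ℕ) := by exact_mod_cast p.2.one_lt
  rw [div_lt_one (by linarith)]
  exact this

theorem summable_eulerTerm (k : ℕ) (p : Nat.Primes) : Summable (eulerTerm (k + 1) p) := by
  refine Summable.of_nonneg_of_le (fun ν => ?_) (fun ν => ?_)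
    (hasSum_pi_geometric (by positivity) (one_div_prime_lt_one p) (k + 1)).summable
  · rw [eulerTerm]
    positivity
  · rw [eulerTerm_eq]
    refine mul_le_of_le_one_left (by positivity) (lcmRatio_le_one fun i => ?_)
    exact pow_ne_zero _ p.2.ne_zero

/-- With `y = 1/p`, `eulerTerm` is `f(p^ν) y^(∑ νᵢ)`, and `f(p^ν)` is the sum of `g(p^μ)` over `μ ≤
ν`. So the series of Euler terms is the Cauchy product of the weights with a `k+1`-fold geometric
series, whose sum `(1 - y)^(-(k+1))` cancels the prefactor of the Euler factor. -/
theorem tsum_lcmWeight_prime_pow (k : ℕ) (p : Nat.Primes) :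
    ∑' ν : Fin (k + 1) → ℕ, lcmWeight (fun i => (p : ℕ) ^ ν i) = eulerFactor (k + 1) p := by
  let _ : Finset.HasAntidiagonal (Fin (k + 1) → ℕ) := Finset.HasAntidiagonal.antidiagonalOfLocallyFinite
  set y : ℝ := 1 / ((p : ℕ) : ℝ) with hy
  have hy1 : y < 1 := one_div_prime_lt_one p
  have hgeo := hasSum_pi_geometric (by positivity) hy1 (k + 1)
  have hW : Summable fun ν : Fin (k + 1) → ℕ => lcmWeight (fun i => (p : ℕ) ^ ν i) :=
    summable_lcmWeight.comp_injective (injective_prime_pow p.2)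
  have hWg := summable_mul_of_summable_norm hW.norm hgeo.summable.norm
  have h1 := Summable.tsum_mul_tsum_eq_tsum_sum_antidiagonal hW hgeo.summable hWg
  have h2 : ∀ ν : Fin (k + 1) → ℕ, ∑ x ∈ Finset.HasAntidiagonal.antidiagonal ν,
      lcmWeight (fun i => (p : ℕ) ^ x.1 i) * y ^ ∑ i, x.2 i = eulerTerm (k + 1) p ν := by
    intro ν
    rw [eulerTerm_eq, ← sum_moebiusTransform lcmRatio fun i => pow_ne_zero (ν i) p.2.ne_zero,
      sum_divisorBox_prime_pow p.2, Finset.sum_mul]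
    refine Finset.sum_congr rfl fun x hx => ?_
    rw [Finset.HasAntidiagonal.mem_antidiagonal] at hx
    have h3 : ∏ i, (((p : ℕ) ^ x.1 i : ℕ) : ℝ) = ((p : ℕ) : ℝ) ^ ∑ i, x.1 i := by
      push_cast
      rw [Finset.prod_pow_eq_pow_sum]
    have h4 : ∑ i, ν i = ∑ i, x.1 i + ∑ i, x.2 i := by
      rw [← hx, ← Finset.sum_add_distrib]
      rfl
    rw [lcmWeight, h3, h4, pow_add, ← hy, div_eq_mul_inv, ← inv_pow, ← one_div, ← hy, mul_assoc]
  simp only [h2] at h1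
  rw [eulerFactor, ← h1, hgeo.tsum_eq, ← hy]
  have : (1 - y) ^ (k + 1) ≠ 0 := pow_ne_zero _ (by linarith)
  field_simp

theorem hasProd_eulerFactor (k : ℕ) :
    HasProd (eulerFactor (k + 1)) (∑' d : Fin (k + 1) → ℕ, lcmWeight d) := by
  have h1 := hasSum_lcmFiberSum (k := k) (W := lcmWeight) (fun _ _ h => lcmWeight_eq_zero h)
    summable_lcmWeight.hasSum
  have h2 := EulerProduct.eulerProduct_hasProd (f := lcmFiberSum (k := k + 1) lcmWeight)
    lcmFiberSum_lcmWeight_one (fun h => lcmFiberSum_lcmWeight_mul h) h1.summable.norm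
    (lcmFiberSum_zero _)
  rw [h1.tsum_eq] at h2
  refine h2.congr_fun fun p => ?_
  rw [(hasSum_lcmFiberSum_prime_pow p.2).tsum_eq, tsum_lcmWeight_prime_pow]

theorem lcmConst_eq_tsum (k : ℕ) :
    lcmConst (k + 1) = ∑' d : Fin (k + 1) → ℕ, lcmWeight d :=
  (hasProd_eulerFactor k).tprod_eq

/-! ### The values of `C_2` and `C_3` -/

/-- The series is split according to `ν i = 0` or `ν i ≥ 1`. Applied to each coordinate in turn,
this isolates the tuples with all entries positive. -/
theorem summable_insertNth_shift {k : ℕ} (i : Fin (k + 1)) {f : (Fin (k + 1) → ℕ) → ℝ}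
    (hf : Summable f) :
    (Summable fun ν : Fin k → ℕ => f (i.insertNth 0 ν)) ∧
    (Summable fun ν : Fin (k + 1) → ℕ => f (i.insertNth (ν i + 1) (i.removeNth ν))) ∧
    ∑' ν, f ν = ∑' ν : Fin k → ℕ, f (i.insertNth 0 ν) +
      ∑' ν : Fin (k + 1) → ℕ, f (i.insertNth (ν i + 1) (i.removeNth ν)) := by
  have hinj0 : Function.Injective
      fun ν : Fin k → ℕ => (i.insertNth 0 ν : Fin (k + 1) → ℕ) := fun ν ν' h => by
    have := congrArg (fun d => i.removeNth d) h
    simpa using this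
  have hinj1 : Function.Injective
      fun ν : Fin (k + 1) → ℕ => (i.insertNth (ν i + 1) (i.removeNth ν) : Fin (k + 1) → ℕ) :=
    fun ν ν' h => by
      have h1 := congrArg (fun d => i.removeNth d) h
      have h2 := congrFun h i
      simp only [Fin.removeNth_insertNth, Fin.insertNth_apply_same, add_left_inj] at h1 h2
      rw [← Fin.insertNth_self_removeNth i ν, h1, h2, Fin.insertNth_self_removeNth]
  have h0 := hf.comp_injective hinj0
  have h1 := hf.comp_injective hinj1
  refine ⟨h0, h1, HasSum.tsum_eq ?_⟩
  have hc : IsCompl (Set.range fun ν : Fin k → ℕ => (i.insertNth 0 ν : Fin (k + 1) → ℕ))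
      (Set.range fun ν : Fin (k + 1) → ℕ =>
        (i.insertNth (ν i + 1) (i.removeNth ν) : Fin (k + 1) → ℕ)) := by
    refine ⟨Set.disjoint_left.2 ?_, codisjoint_iff_le_sup.2 ?_⟩
    · rintro _ ⟨ν, rfl⟩ ⟨ν', h⟩
      have := congrFun h i
      simp at this
    · intro ν _
      rcases hν : ν i with _ | a
      · left
        exact ⟨i.removeNth ν, by simp only [← hν, Fin.insertNth_self_removeNth]⟩
      · right
        exact ⟨i.insertNth a (i.removeNth ν), by
          simp only [Fin.insertNth_apply_same, Fin.removeNth_insertNth, ← hν,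
            Fin.insertNth_self_removeNth]⟩
  exact HasSum.add_isCompl hc (hinj0.hasSum_range_iff.2 h0.hasSum)
    (hinj1.hasSum_range_iff.2 h1.hasSum)

/-- The exponent `2 (a + b) - max a b`. -/
def expTwo (a b : ℕ) : ℕ := 2 * (a + b) - max a b

/-- The exponent `2 (a + b + c) - max a b c`. -/
def expThree (a b c : ℕ) : ℕ := 2 * (a + b + c) - max a (max b c)

theorem eulerTerm_eq_pow {k : ℕ} (p : Nat.Primes) (ν : Fin k → ℕ) :
    eulerTerm k p ν = (1 / ((p : ℕ) : ℝ)) ^ (2 * ∑ i, ν i - Finset.univ.sup ν) := by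
  have h : Finset.univ.sup ν ≤ 2 * ∑ i, ν i :=
    (Finset.sup_le fun i hi => Finset.single_le_sum (fun j _ => Nat.zero_le (ν j)) hi).trans
      (Nat.le_mul_of_pos_left _ two_pos)
  have h2 : 2 * ∑ i, (ν i : ℤ) - ((Finset.univ.sup ν : ℕ) : ℤ) =
      ((2 * ∑ i, ν i - Finset.univ.sup ν : ℕ) : ℤ) := by
    rw [Nat.cast_sub h]
    push_cast
    rfl
  rw [eulerTerm, h2, zpow_natCast, one_div_pow]

theorem eulerTerm_two (p : Nat.Primes) (ν : Fin 2 → ℕ) :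
    eulerTerm 2 p ν = (1 / ((p : ℕ) : ℝ)) ^ expTwo (ν 0) (ν 1) := by
  have h : (Finset.univ : Finset (Fin 2)) = {0, 1} := rfl
  rw [eulerTerm_eq_pow, expTwo, Fin.sum_univ_two, h, Finset.sup_insert, Finset.sup_singleton]

theorem eulerTerm_three (p : Nat.Primes) (ν : Fin 3 → ℕ) :
    eulerTerm 3 p ν = (1 / ((p : ℕ) : ℝ)) ^ expThree (ν 0) (ν 1) (ν 2) := by
  have h : (Finset.univ : Finset (Fin 3)) = {0, 1, 2} := rfl
  rw [eulerTerm_eq_pow, expThree, Fin.sum_univ_three, h, Finset.sup_insert, Finset.sup_insert,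
    Finset.sup_singleton]

theorem tsum_pow_one {y : ℝ} (hy0 : 0 ≤ y) (hy1 : y < 1) :
    ∑' ν : Fin 1 → ℕ, y ^ ν 0 = (1 - y)⁻¹ := by
  have := (hasSum_pi_geometric hy0 hy1 1).tsum_eq
  simpa using this

theorem tsum_expTwo_eq {y : ℝ} (hs : Summable fun ν : Fin 2 → ℕ => y ^ expTwo (ν 0) (ν 1)) :
    ∑' ν : Fin 2 → ℕ, y ^ expTwo (ν 0) (ν 1) = ∑' ν : Fin 1 → ℕ, y ^ ν 0 +
      ∑' ν : Fin 2 → ℕ, y ^ expTwo (ν 0 + 1) (ν 1) := by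
  obtain ⟨-, -, h⟩ := summable_insertNth_shift 0 hs
  rw [h]
  congr 1
  · refine tsum_congr fun ν => ?_
    congr 1
    simp [expTwo]
    omega

/-- Tuples with a zero entry give geometric series. Adding `1` to both entries raises the exponent
by `4 - 1 = 3`, so the rest is `y³` times the whole series. -/
theorem tsum_expTwo {y : ℝ} (hy0 : 0 ≤ y) (hy1 : y < 1)
    (hs : Summable fun ν : Fin 2 → ℕ => y ^ expTwo (ν 0) (ν 1)) :
    (∑' ν : Fin 2 → ℕ, y ^ expTwo (ν 0) (ν 1)) * (1 - y ^ 3) = (1 + y) * (1 - y)⁻¹ := by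
  obtain ⟨-, hs1, -⟩ := summable_insertNth_shift 0 hs
  replace hs1 : Summable fun ν : Fin 2 → ℕ => y ^ expTwo (ν 0 + 1) (ν 1) :=
    hs1.congr fun ν => congrArg (y ^ ·) rfl
  obtain ⟨-, -, h⟩ := summable_insertNth_shift 1 hs1
  have h1 := tsum_expTwo_eq hs
  have h2 : ∑' ν : Fin 2 → ℕ, y ^ expTwo (ν 0 + 1) (ν 1) =
      ∑' ν : Fin 1 → ℕ, y * y ^ ν 0 + ∑' ν : Fin 2 → ℕ, y ^ 3 * y ^ expTwo (ν 0) (ν 1) := by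
    simp only [← pow_add, ← pow_succ']
    refine h.trans (congrArg₂ _ (tsum_congr fun ν => congrArg (y ^ ·) ?_)
      (tsum_congr fun ν => congrArg (y ^ ·) ?_))
    · change expTwo (ν 0 + 1) 0 = _
      simp only [expTwo]
      omega
    · change expTwo (ν 0 + 1) (ν 1 + 1) = _
      simp only [expTwo]
      omega
  rw [tsum_mul_left, tsum_mul_left, tsum_pow_one hy0 hy1] at h2
  rw [tsum_pow_one hy0 hy1, h2] at h1
  linear_combination h1

/-- Write `S₂`, `S₃` for the two series. The first zero entry in position `0`, `1` or `2`
contributes `S₂`, `S₂ - (1 - y)⁻¹` and `y³ S₂`. Adding `1` to all three entries raises the exponent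
by `6 - 1 = 5`, so the rest is `y⁵ S₃`. -/
theorem tsum_expThree {y : ℝ} (hy0 : 0 ≤ y) (hy1 : y < 1)
    (hs2 : Summable fun ν : Fin 2 → ℕ => y ^ expTwo (ν 0) (ν 1))
    (hs : Summable fun ν : Fin 3 → ℕ => y ^ expThree (ν 0) (ν 1) (ν 2)) :
    (∑' ν : Fin 3 → ℕ, y ^ expThree (ν 0) (ν 1) (ν 2)) * (1 - y ^ 5) =
      (2 + y ^ 3) * (∑' ν : Fin 2 → ℕ, y ^ expTwo (ν 0) (ν 1)) - (1 - y)⁻¹ := by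
  obtain ⟨-, hs1, h1⟩ := summable_insertNth_shift 0 hs
  replace hs1 : Summable fun ν : Fin 3 → ℕ => y ^ expThree (ν 0 + 1) (ν 1) (ν 2) :=
    hs1.congr fun ν => congrArg (y ^ ·) rfl
  obtain ⟨-, hs3, h3⟩ := summable_insertNth_shift 1 hs1
  replace hs3 : Summable fun ν : Fin 3 → ℕ => y ^ expThree (ν 0 + 1) (ν 1 + 1) (ν 2) :=
    hs3.congr fun ν => congrArg (y ^ ·) rfl
  obtain ⟨-, -, h5⟩ := summable_insertNth_shift 2 hs3
  have e1 : ∑' ν : Fin 3 → ℕ, y ^ expThree (ν 0) (ν 1) (ν 2) =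
      ∑' ν : Fin 2 → ℕ, y ^ expTwo (ν 0) (ν 1) +
        ∑' ν : Fin 3 → ℕ, y ^ expThree (ν 0 + 1) (ν 1) (ν 2) := by
    refine h1.trans (congrArg₂ _ (tsum_congr fun ν => congrArg (y ^ ·) ?_)
      (tsum_congr fun ν => congrArg (y ^ ·) rfl))
    change expThree 0 (ν 0) (ν 1) = _
    simp only [expThree, expTwo]
    omega
  have e3 : ∑' ν : Fin 3 → ℕ, y ^ expThree (ν 0 + 1) (ν 1) (ν 2) =
      ∑' ν : Fin 2 → ℕ, y ^ expTwo (ν 0 + 1) (ν 1) +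
        ∑' ν : Fin 3 → ℕ, y ^ expThree (ν 0 + 1) (ν 1 + 1) (ν 2) := by
    refine h3.trans (congrArg₂ _ (tsum_congr fun ν => congrArg (y ^ ·) ?_)
      (tsum_congr fun ν => congrArg (y ^ ·) rfl))
    change expThree (ν 0 + 1) 0 (ν 1) = _
    simp only [expThree, expTwo]
    omega
  have e5 : ∑' ν : Fin 3 → ℕ, y ^ expThree (ν 0 + 1) (ν 1 + 1) (ν 2) =
      ∑' ν : Fin 2 → ℕ, y ^ 3 * y ^ expTwo (ν 0) (ν 1) +
        ∑' ν : Fin 3 → ℕ, y ^ 5 * y ^ expThree (ν 0) (ν 1) (ν 2) := by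
    simp only [← pow_add]
    refine h5.trans (congrArg₂ _ (tsum_congr fun ν => congrArg (y ^ ·) ?_)
      (tsum_congr fun ν => congrArg (y ^ ·) ?_))
    · change expThree (ν 0 + 1) (ν 1 + 1) 0 = _
      simp only [expThree, expTwo]
      omega
    · change expThree (ν 0 + 1) (ν 1 + 1) (ν 2 + 1) = _
      simp only [expThree]
      omega
  rw [tsum_mul_left, tsum_mul_left] at e5
  have e2 := tsum_expTwo_eq hs2
  rw [tsum_pow_one hy0 hy1] at e2
  rw [e3, e5] at e1
  linear_combination e1 - e2

theorem eulerFactor_two (p : Nat.Primes) :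
    eulerFactor 2 p = (1 - (1 / ((p : ℕ) : ℝ)) ^ 2) * (1 - (1 / ((p : ℕ) : ℝ)) ^ 3)⁻¹ := by
  have hs := (summable_eulerTerm 1 p).congr (eulerTerm_two p)
  have hy0 : 0 ≤ 1 / ((p : ℕ) : ℝ) := by positivity
  have hy1 := one_div_prime_lt_one p
  have h := tsum_expTwo hy0 hy1 hs
  rw [eulerFactor, tsum_congr (eulerTerm_two p)]
  set y : ℝ := 1 / ((p : ℕ) : ℝ)
  have h1 : 1 - y ≠ 0 := by linarith
  have h3 : 1 - y ^ 3 ≠ 0 := by have := pow_lt_one₀ hy0 hy1 three_ne_zero; linarith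
  rw [← eq_mul_inv_iff_mul_eq₀ h3] at h
  rw [h]
  field_simp
  ring

theorem cubicFactor_eq (p : Nat.Primes) :
    cubicFactor p = eulerFactor 3 p * (1 - (1 / ((p : ℕ) : ℝ)) ^ 3) *
      (1 - (1 / ((p : ℕ) : ℝ)) ^ 5) := by
  have hs2 := (summable_eulerTerm 1 p).congr (eulerTerm_two p)
  have hs := (summable_eulerTerm 2 p).congr (eulerTerm_three p)
  have hy0 : 0 ≤ 1 / ((p : ℕ) : ℝ) := by positivity
  have hy1 := one_div_prime_lt_one p
  have h2 := tsum_expTwo hy0 hy1 hs2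
  have h := tsum_expThree hy0 hy1 hs2 hs
  have hc : cubicFactor p = 1 - 3 * (1 / ((p : ℕ) : ℝ)) ^ 2 + 4 * (1 / ((p : ℕ) : ℝ)) ^ 3 -
      3 * (1 / ((p : ℕ) : ℝ)) ^ 4 + (1 / ((p : ℕ) : ℝ)) ^ 6 := by
    rw [cubicFactor]
    simp only [one_div_pow]
    ring
  rw [hc, eulerFactor, tsum_congr (eulerTerm_three p)]
  set y : ℝ := 1 / ((p : ℕ) : ℝ)
  have h1 : 1 - y ≠ 0 := by linarith
  have hi : (1 - y) * (1 - y)⁻¹ = 1 := mul_inv_cancel₀ h1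
  -- Eliminating both series leaves `(1 - y)² ((2 + y³)(1 + y) - (1 - y³)) = 1 - 3y² + 4y³ - 3y⁴ +
  -- y⁶`.
  linear_combination (-(1 - y) ^ 3 * (1 - y ^ 3)) * h - (1 - y) ^ 3 * (2 + y ^ 3) * h2 -
    (1 - y) ^ 2 * ((2 + y ^ 3) * (1 + y) - (1 - y ^ 3)) * hi

theorem hasProd_zeta {n : ℕ} (hn : 2 ≤ n) :
    HasProd (fun p : Nat.Primes => (((1 - (1 / ((p : ℕ) : ℝ)) ^ n)⁻¹ : ℝ) : ℂ)) (riemannZeta n) := by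
  have h := riemannZeta_eulerProduct_hasProd (s := n) (by
    rw [Complex.natCast_re]
    exact_mod_cast hn)
  refine h.congr_fun fun p => ?_
  rw [Complex.cpow_neg, Complex.cpow_natCast]
  push_cast
  rw [one_div_pow, one_div]

theorem multipliable_one_sub_pow {n : ℕ} (hn : 2 ≤ n) :
    Multipliable fun p : Nat.Primes => 1 - (1 / ((p : ℕ) : ℝ)) ^ n := by
  have h1 : Summable fun p : Nat.Primes => (1 / ((p : ℕ) : ℝ)) ^ n := by
    have := (Real.summable_one_div_nat_pow.2 hn).comp_injective Nat.Primes.coe_nat_injective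
    refine this.congr fun p => ?_
    simp
  have h2 := Real.multipliable_one_add_of_summable h1.neg
  exact h2.congr fun p => by ring

theorem one_sub_one_div_prime_pow_ne_zero {n : ℕ} (hn : 2 ≤ n) (p : Nat.Primes) :
    1 - (1 / ((p : ℕ) : ℝ)) ^ n ≠ 0 := by
  have := pow_lt_one₀ (by positivity) (one_div_prime_lt_one p) (by omega : n ≠ 0)
  linarith

theorem HasProd.complex_ofReal {ι : Type*} {f : ι → ℝ} {a : ℝ} (h : HasProd f a) :
    HasProd (fun i => (f i : ℂ)) (a : ℂ) :=
  h.map Complex.ofRealHom Complex.continuous_ofReal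

theorem multipliable_eulerFactor {k : ℕ} (hk : 1 ≤ k) : Multipliable (eulerFactor k) := by
  obtain ⟨k, rfl⟩ := Nat.exists_eq_add_of_le' hk
  exact (hasProd_eulerFactor k).multipliable

theorem multipliable_cubicFactor : Multipliable cubicFactor := by
  have h := ((multipliable_eulerFactor (k := 3) (by norm_num)).mul
    (multipliable_one_sub_pow (n := 3) (by norm_num))).mul
    (multipliable_one_sub_pow (n := 5) (by norm_num))
  exact h.congr fun p => (cubicFactor_eq p).symm

theorem lcmConst_two : (lcmConst 2 : ℂ) = riemannZeta 3 / riemannZeta 2 := by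
  have hz2 := hasProd_zeta (n := 2) le_rfl
  have hz3 := hasProd_zeta (n := 3) (by norm_num)
  have h := (multipliable_eulerFactor (k := 2) (by norm_num)).hasProd.complex_ofReal.mul hz2
  have h2 : (lcmConst 2 : ℂ) * riemannZeta (2 : ℕ) = riemannZeta (3 : ℕ) := by
    refine h.unique (hz3.congr_fun fun p => ?_)
    rw [← Complex.ofReal_mul, eulerFactor_two]
    have := one_sub_one_div_prime_pow_ne_zero (n := 2) le_rfl p
    congr 1
    rw [mul_right_comm, mul_inv_cancel₀ this, one_mul]
  push_cast at h2
  rw [eq_div_iff (riemannZeta_ne_zero_of_one_lt_re (by norm_num)), h2]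

theorem lcmConst_three : (lcmConst 3 : ℂ) =
    riemannZeta 3 * riemannZeta 5 * ((∏' p : Nat.Primes, cubicFactor p : ℝ) : ℂ) := by
  have hz3 := hasProd_zeta (n := 3) (by norm_num)
  have hz5 := hasProd_zeta (n := 5) (by norm_num)
  have h := (hz3.mul hz5).mul multipliable_cubicFactor.hasProd.complex_ofReal
  have hE := (multipliable_eulerFactor (k := 3) (by norm_num)).hasProd.complex_ofReal
  push_cast at h
  refine hE.unique (h.congr_fun fun p => ?_)
  have h3 := one_sub_one_div_prime_pow_ne_zero (n := 3) (by norm_num) p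
  have h5 := one_sub_one_div_prime_pow_ne_zero (n := 5) (by norm_num) p
  have : eulerFactor 3 p = (1 - (1 / ((p : ℕ) : ℝ)) ^ 3)⁻¹ * (1 - (1 / ((p : ℕ) : ℝ)) ^ 5)⁻¹ *
      cubicFactor p := by
    rw [cubicFactor_eq, ← mul_inv, eq_inv_mul_iff_mul_eq₀ (mul_ne_zero h3 h5)]
    ring
  rw [this]
  push_cast
  rfl

/-! ### The asymptotic formula with saving `x^(1/4)` -/

/-- Expand `f` by Möbius inversion and exchange the summations. Only finitely many `d` matter, since
the others divide no tuple of the ball. -/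
theorem hasSum_natLcmSum (k : ℕ) (x : ℝ) :
    HasSum (fun d : Fin k → ℕ => moebiusTransform lcmRatio d * latticeSum d x) (natLcmSum k x) := by
  classical
  set B := (natBall_finite k x).toFinset with hB
  have hne : ∀ n ∈ B, ∀ i, n i ≠ 0 := fun n hn i =>
    Nat.one_le_iff_ne_zero.1 ((mem_natBall_toFinset.1 hn).1 i)
  have hbox : ∀ n ∈ B, ∀ d, d ∈ divisorBox n ↔ ∀ i, d i ∣ n i := fun n hn d => by
    rw [mem_divisorBox]
    exact ⟨fun h i => (h i).1, fun h i => ⟨h i, hne n hn i⟩⟩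
  have h1 : natLcmSum k x = ∑ d ∈ B.biUnion divisorBox,
      moebiusTransform lcmRatio d * latticeSum d x := by
    have h2 : ∀ n ∈ B, ((Finset.univ.lcm n : ℕ) : ℝ) = ∑ d ∈ B.biUnion divisorBox,
        moebiusTransform lcmRatio d * if ∀ i, d i ∣ n i then ∏ i, (n i : ℝ) else 0 := by
      intro n hn
      rw [← lcmRatio_mul_prod (hne n hn), ← sum_moebiusTransform lcmRatio (hne n hn),
        Finset.sum_mul]
      refine Finset.sum_subset_zero_on_sdiff (Finset.subset_biUnion_of_mem _ hn) ?_ ?_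
      · intro d hd
        rw [Finset.mem_sdiff, hbox n hn] at hd
        rw [if_neg hd.2, mul_zero]
      · intro d hd
        rw [if_pos ((hbox n hn d).1 hd)]
    rw [natLcmSum, Finset.sum_congr rfl h2, Finset.sum_comm]
    refine Finset.sum_congr rfl fun d _ => ?_
    rw [latticeSum, Finset.mul_sum]
  rw [h1]
  refine hasSum_sum_of_ne_finset_zero fun d hd => ?_
  rw [latticeSum, Finset.sum_eq_zero, mul_zero]
  intro n hn
  refine if_neg fun h => hd ?_
  rw [Finset.mem_biUnion]
  exact ⟨n, hn, (hbox n hn d).2 h⟩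

theorem abs_natLcmSum_sub_le_tsum (k : ℕ) {x : ℝ} (hx : 0 < x) :
    (Summable fun d : Fin (k + 1) → ℕ =>
      |lcmWeight d| * min 1 (((Finset.univ.lcm d : ℕ) : ℝ) / √x)) ∧
    |natLcmSum (k + 1) x -
      lcmConst (k + 1) / (2 ^ (k + 1) * ((k + 1).factorial : ℝ)) * x ^ (k + 1)| ≤
      2 * (k + 1 : ℕ) * x ^ (k + 1) *
        ∑' d : Fin (k + 1) → ℕ, |lcmWeight d| * min 1 (((Finset.univ.lcm d : ℕ) : ℝ) / √x) := by
  set c : ℝ := x ^ (k + 1) / (2 ^ (k + 1) * ((k + 1).factorial : ℝ)) with hc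
  have hs : Summable fun d : Fin (k + 1) → ℕ =>
      |lcmWeight d| * min 1 (((Finset.univ.lcm d : ℕ) : ℝ) / √x) :=
    Summable.of_nonneg_of_le (fun d => by positivity)
      (fun d => mul_le_of_le_one_right (abs_nonneg _) (min_le_left _ _)) summable_lcmWeight.abs
  refine ⟨hs, ?_⟩
  have h1 := (hasSum_natLcmSum (k + 1) x).sub
    ((summable_lcmWeight (k := k)).hasSum.mul_left c)
  rw [← lcmConst_eq_tsum] at h1
  have h2 : c * lcmConst (k + 1) =
      lcmConst (k + 1) / (2 ^ (k + 1) * ((k + 1).factorial : ℝ)) * x ^ (k + 1) := by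
    rw [hc]
    ring
  rw [h2] at h1
  rw [← h1.tsum_eq, ← Real.norm_eq_abs, ← tsum_mul_left]
  refine tsum_of_norm_bounded (hs.mul_left _).hasSum fun d => ?_
  rw [Real.norm_eq_abs]
  by_cases hd : ∃ i, d i = 0
  · obtain ⟨i, hi⟩ := hd
    rw [moebiusTransform_eq_zero_of_eq_zero _ hi, lcmWeight_eq_zero hi]
    simp
  · push Not at hd
    have hL := univ_lcm_ne_zero hd
    have hP : 0 < ∏ i, (d i : ℝ) :=
      Finset.prod_pos fun i _ => by exact_mod_cast Nat.pos_of_ne_zero (hd i)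
    have h3 := abs_latticeSum_sub_le (k := k + 1) (d := d) (by omega)
      (fun i => Nat.one_le_iff_ne_zero.2 (hd i)) (D := ((Finset.univ.lcm d : ℕ) : ℝ))
      (fun i => by
        exact_mod_cast Nat.le_of_dvd (Nat.pos_of_ne_zero hL) (Finset.dvd_lcm (Finset.mem_univ i)))
      hx
    have h4 : moebiusTransform lcmRatio d * latticeSum d x - c * lcmWeight d =
        moebiusTransform lcmRatio d * (latticeSum d x - c / ∏ i, (d i : ℝ)) := by
      rw [lcmWeight]
      ring
    rw [h4, abs_mul]
    refine (mul_le_mul_of_nonneg_left h3 (abs_nonneg _)).trans (le_of_eq ?_)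
    rw [lcmWeight, abs_div, abs_of_pos hP]
    ring

theorem natLcmSum_sub_isBigO {k : ℕ} (hk : 1 ≤ k) {ε : ℝ} (hε : 0 < ε) :
    (fun x : ℝ => natLcmSum k x - lcmConst k / (2 ^ k * (k.factorial : ℝ)) * x ^ k)
      =O[atTop] fun x : ℝ => x ^ ((k : ℝ) - 1 / 4 + ε) := by
  obtain ⟨k, rfl⟩ := Nat.exists_eq_add_of_le' hk
  refine IsBigO.of_bound (2 * (k + 1 : ℕ) * ∑' d : Fin (k + 1) → ℕ,
    |lcmWeight d| * ((Finset.univ.lcm d : ℕ) : ℝ) ^ (1 / 2 : ℝ)) ?_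
  filter_upwards [eventually_ge_atTop 1] with x hx
  have hx0 : 0 < x := by linarith
  obtain ⟨hs, h⟩ := abs_natLcmSum_sub_le_tsum k hx0
  rw [Real.norm_eq_abs, Real.norm_eq_abs, abs_of_pos (Real.rpow_pos_of_pos hx0 _)]
  refine h.trans ?_
  have h1 : ∑' d : Fin (k + 1) → ℕ, |lcmWeight d| * min 1 (((Finset.univ.lcm d : ℕ) : ℝ) / √x) ≤
      (∑' d : Fin (k + 1) → ℕ, |lcmWeight d| * ((Finset.univ.lcm d : ℕ) : ℝ) ^ (1 / 2 : ℝ)) *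
        x ^ (-(1 / 4) : ℝ) := by
    rw [← tsum_mul_right]
    refine hs.tsum_le_tsum (fun d => ?_) (summable_abs_lcmWeight_mul.mul_right _)
    rw [mul_assoc]
    refine mul_le_mul_of_nonneg_left ?_ (abs_nonneg _)
    set L : ℝ := ((Finset.univ.lcm d : ℕ) : ℝ)
    have hL : 0 ≤ L := Nat.cast_nonneg _
    -- What is needed is `min(1, t) ≤ t^(1/2)` for `t = L / √x`.
    have h2 : L ^ (1 / 2 : ℝ) * x ^ (-(1 / 4) : ℝ) = (L / √x) ^ (1 / 2 : ℝ) := by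
      have h4 : (1 / 2 : ℝ) * (1 / 2) = 1 / 4 := by norm_num
      rw [Real.div_rpow hL (Real.sqrt_nonneg x), Real.sqrt_eq_rpow, ← Real.rpow_mul hx0.le,
        h4, Real.rpow_neg hx0.le]
      exact (div_eq_mul_inv _ _).symm
    rw [h2]
    rcases le_total (L / √x) 1 with h3 | h3
    · rw [min_eq_right h3]
      exact Real.self_le_rpow_of_le_one (by positivity) h3 (by norm_num)
    · rw [min_eq_left h3]
      exact Real.one_le_rpow h3 (by norm_num)
  have h2 : x ^ (k + 1) * x ^ (-(1 / 4) : ℝ) ≤ x ^ (((k + 1 : ℕ) : ℝ) - 1 / 4 + ε) := by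
    rw [← Real.rpow_natCast, ← Real.rpow_add hx0]
    refine Real.rpow_le_rpow_of_exponent_le hx ?_
    linarith
  have h0 : 0 ≤ ∑' d : Fin (k + 1) → ℕ,
      |lcmWeight d| * ((Finset.univ.lcm d : ℕ) : ℝ) ^ (1 / 2 : ℝ) :=
    tsum_nonneg fun d => by positivity
  calc _ ≤ 2 * (k + 1 : ℕ) * x ^ (k + 1) * ((∑' d : Fin (k + 1) → ℕ,
        |lcmWeight d| * ((Finset.univ.lcm d : ℕ) : ℝ) ^ (1 / 2 : ℝ)) * x ^ (-(1 / 4) : ℝ)) := by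
        gcongr
    _ = 2 * (k + 1 : ℕ) * (∑' d : Fin (k + 1) → ℕ,
        |lcmWeight d| * ((Finset.univ.lcm d : ℕ) : ℝ) ^ (1 / 2 : ℝ)) *
          (x ^ (k + 1) * x ^ (-(1 / 4) : ℝ)) := by ring
    _ ≤ _ := by gcongr

/-! ### The sharper error term for `k = 2` -/

theorem invMoebius_prime_pow {p : ℕ} (hp : p.Prime) (e : ℕ) :
    invMoebius (p ^ (e + 1)) = 1 / (p : ℝ) ^ (e + 1) - 1 / (p : ℝ) ^ e := by
  have h1 := sum_divisors_invMoebius (pow_ne_zero e hp.ne_zero)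
  have h2 := sum_divisors_invMoebius (pow_ne_zero (e + 1) hp.ne_zero)
  rw [Nat.sum_divisors_prime_pow hp] at h1 h2
  rw [Finset.sum_range_succ, h1] at h2
  push_cast at h2
  linarith

theorem invMoebius_mul {a b : ℕ} (hab : a.Coprime b) :
    invMoebius (a * b) = invMoebius a * invMoebius b := by
  have hf : (ArithmeticFunction.moebius : ArithmeticFunction ℝ).IsMultiplicative :=
    ArithmeticFunction.isMultiplicative_moebius.intCast
  let g : ArithmeticFunction ℝ := ⟨fun n => 1 / (n : ℝ), by simp⟩
  have hg : g.IsMultiplicative := by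
    refine ⟨by simp [g], fun {m n} _ => ?_⟩
    simp only [g, ArithmeticFunction.coe_mk]
    push_cast
    rw [one_div_mul_one_div]
  have h := (hf.mul hg).map_mul_of_coprime hab
  rw [ArithmeticFunction.mul_apply, ArithmeticFunction.mul_apply, ArithmeticFunction.mul_apply] at h
  exact h

theorem abs_invMoebius_le_one (n : ℕ) : |invMoebius n| ≤ 1 := by
  induction n using Nat.recOnPosPrimePosCoprime with
  | zero => simp [invMoebius]
  | one => simp [invMoebius]
  | prime_pow p e hp he =>
    obtain ⟨e, rfl⟩ := Nat.exists_eq_add_of_lt he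
    rw [zero_add, invMoebius_prime_pow hp]
    have h1 : (1 : ℝ) ≤ p := by exact_mod_cast hp.one_le
    have h2 : 1 / (p : ℝ) ^ (e + 1) ≤ 1 / (p : ℝ) ^ e := by
      exact one_div_le_one_div_of_le (by positivity) (pow_le_pow_right₀ h1 (Nat.le_succ e))
    have h3 : 1 / (p : ℝ) ^ e ≤ 1 := by
      rw [div_le_one (by positivity)]
      exact one_le_pow₀ h1
    have h4 : 0 ≤ 1 / (p : ℝ) ^ (e + 1) := by positivity
    rw [abs_le]
    constructor <;> linarith
  | coprime a b _ _ hab ha hb =>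
    rw [invMoebius_mul hab, abs_mul]
    exact mul_le_one₀ ha (abs_nonneg _) hb

/-- For two entries the ratio is `1 / gcd`, that is, the sum of `invMoebius c` over common divisors
`c`. These correspond to the diagonal tuples `(c, c)`, and uniqueness of the transform applies. -/
theorem moebiusTransform_lcmRatio_two {d : Fin 2 → ℕ} (hd : ∀ i, d i ≠ 0) :
    moebiusTransform lcmRatio d = if d 0 = d 1 then invMoebius (d 0) else 0 := by
  refine moebiusTransform_eq (G := fun d => if d 0 = d 1 then invMoebius (d 0) else 0)
    (fun n hn => ?_) hd
  have hg : (n 0).gcd (n 1) ≠ 0 := (Nat.gcd_pos_of_pos_left _ (Nat.pos_of_ne_zero (hn 0))).ne'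
  have h1 : lcmRatio n = 1 / ((n 0).gcd (n 1) : ℝ) := by
    have h2 : (Finset.univ.lcm n : ℕ) = (n 0).lcm (n 1) := by
      have : (Finset.univ : Finset (Fin 2)) = {0, 1} := rfl
      rw [this, Finset.lcm_insert, Finset.lcm_singleton, normalize_eq]
      rfl
    have h3 : ((n 0).gcd (n 1) : ℝ) * ((n 0).lcm (n 1) : ℝ) = n 0 * n 1 := by
      exact_mod_cast Nat.gcd_mul_lcm _ _
    have h4 : (n 0 : ℝ) * n 1 ≠ 0 :=
      mul_ne_zero (by exact_mod_cast hn 0) (by exact_mod_cast hn 1)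
    have h5 : ((n 0).gcd (n 1) : ℝ) ≠ 0 := by exact_mod_cast hg
    rw [lcmRatio, h2, Fin.prod_univ_two, div_eq_div_iff h4 h5]
    linarith
  rw [h1, ← sum_divisors_invMoebius hg, ← Finset.sum_filter]
  refine Finset.sum_nbij' (fun d => d 0) (fun c _ => c) ?_ ?_ ?_ ?_ ?_
  · intro d hd
    rw [Finset.mem_filter, mem_divisorBox] at hd
    rw [Nat.mem_divisors, Nat.dvd_gcd_iff]
    exact ⟨⟨(hd.1 0).1, hd.2 ▸ (hd.1 1).1⟩, hg⟩
  · intro c hc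
    rw [Nat.mem_divisors, Nat.dvd_gcd_iff] at hc
    rw [Finset.mem_filter, mem_divisorBox]
    refine ⟨fun i => ⟨?_, hn i⟩, rfl⟩
    fin_cases i
    · exact hc.1.1
    · exact hc.1.2
  · intro d hd
    funext i
    fin_cases i
    · rfl
    · exact (Finset.mem_filter.1 hd).2
  · intro c _
    rfl
  · intro d _
    rfl

theorem abs_lcmWeight_two_le (c : ℕ) : |lcmWeight (fun _ : Fin 2 => c)| ≤ ((c : ℝ) ^ 2)⁻¹ := by
  rcases Nat.eq_zero_or_pos c with rfl | hc
  · simp [lcmWeight]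
  · rw [lcmWeight, moebiusTransform_lcmRatio_two fun _ => hc.ne', if_pos rfl, Fin.prod_univ_two,
      abs_div, ← sq, abs_of_pos (by positivity : (0 : ℝ) < (c : ℝ) ^ 2), ← one_div]
    gcongr
    exact abs_invMoebius_le_one c

/-- For `c ≤ y` the terms are at most `1 / (c y)`, a harmonic sum over `y`; the tail of `∑ c⁻²`
beyond `y` is at most `2 / y`. -/
theorem sum_range_min_le {y : ℝ} (hy : 1 ≤ y) (n : ℕ) :
    ∑ c ∈ Finset.range n, ((c : ℝ) ^ 2)⁻¹ * min 1 (c / y) ≤ (3 + Real.log y) / y := by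
  set N := ⌊y⌋₊ with hN
  have hy0 : 0 < y := by linarith
  have hNy : (N : ℝ) ≤ y := Nat.floor_le hy0.le
  have hN1 : 1 ≤ N := Nat.le_floor (by simpa using hy)
  have hyN : y ≤ N + 1 := (Nat.lt_floor_add_one y).le
  have h1 : ∑ c ∈ Finset.range n, ((c : ℝ) ^ 2)⁻¹ * min 1 (c / y) ≤
      ∑ c ∈ Finset.Icc 1 N, (c : ℝ)⁻¹ / y + ∑ c ∈ Finset.Ioo N n, ((c : ℝ) ^ 2)⁻¹ := by
    have h2 : ∀ c ∈ Finset.range n, ((c : ℝ) ^ 2)⁻¹ * min 1 (c / y) ≤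
        (if c ∈ Finset.Icc 1 N then (c : ℝ)⁻¹ / y else 0) +
          if c ∈ Finset.Ioo N n then ((c : ℝ) ^ 2)⁻¹ else 0 := by
      intro c hc
      rw [Finset.mem_range] at hc
      rcases Nat.eq_zero_or_pos c with rfl | hc0
      · simp
      rcases le_or_gt c N with h | h
      · rw [if_pos (Finset.mem_Icc.2 ⟨hc0, h⟩), if_neg (by simp [h]), add_zero]
        have hc' : (c : ℝ) ≠ 0 := by exact_mod_cast hc0.ne'
        refine (mul_le_mul_of_nonneg_left (min_le_right _ _) (by positivity)).trans (le_of_eq ?_)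
        field_simp
      · rw [if_pos (Finset.mem_Ioo.2 ⟨h, hc⟩), if_neg (by simp [h]), zero_add]
        exact mul_le_of_le_one_right (by positivity) (min_le_left _ _)
    refine (Finset.sum_le_sum h2).trans ?_
    rw [Finset.sum_add_distrib, ← Finset.sum_filter, ← Finset.sum_filter]
    refine add_le_add (Finset.sum_le_sum_of_subset_of_nonneg ?_ fun _ _ _ => by positivity)
      (Finset.sum_le_sum_of_subset_of_nonneg ?_ fun _ _ _ => by positivity)
    · exact fun c hc => (Finset.mem_filter.1 hc).2
    · exact fun c hc => (Finset.mem_filter.1 hc).2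
  have h2 : ∑ c ∈ Finset.Icc 1 N, (c : ℝ)⁻¹ ≤ 1 + Real.log y := by
    have h3 := harmonic_le_one_add_log N
    rw [harmonic_eq_sum_Icc] at h3
    push_cast at h3
    refine h3.trans ?_
    have : Real.log N ≤ Real.log y := Real.log_le_log (by exact_mod_cast hN1) hNy
    linarith
  have h3 : ∑ c ∈ Finset.Ioo N n, ((c : ℝ) ^ 2)⁻¹ ≤ 2 / y :=
    (sum_Ioo_inv_sq_le N n).trans (by gcongr)
  rw [← Finset.sum_div] at h1
  refine h1.trans ((add_le_add (div_le_div_of_nonneg_right h2 hy0.le) h3).trans (le_of_eq ?_))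
  ring

theorem tsum_lcmWeight_two_le {y : ℝ} (hy : 1 ≤ y) :
    ∑' d : Fin 2 → ℕ, |lcmWeight d| * min 1 (((Finset.univ.lcm d : ℕ) : ℝ) / y) ≤
      (3 + Real.log y) / y := by
  have hinj : Function.Injective fun (c : ℕ) (_ : Fin 2) => c := fun c c' h => congrFun h 0
  have hsupp : Function.support (fun d : Fin 2 → ℕ =>
      |lcmWeight d| * min 1 (((Finset.univ.lcm d : ℕ) : ℝ) / y)) ⊆
      Set.range fun (c : ℕ) (_ : Fin 2) => c := by
    intro d hd
    by_contra hr
    have h01 : d 0 ≠ d 1 := fun h => hr ⟨d 0, by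
      funext i
      fin_cases i
      · rfl
      · exact h⟩
    have : lcmWeight d = 0 := by
      by_cases h0 : ∃ i, d i = 0
      · obtain ⟨i, hi⟩ := h0
        exact lcmWeight_eq_zero hi
      · push Not at h0
        rw [lcmWeight, moebiusTransform_lcmRatio_two h0, if_neg h01, zero_div]
    exact hd (by simp [this])
  rw [← hinj.tsum_eq hsupp]
  refine Real.tsum_le_of_sum_range_le (fun c => by positivity) fun n => ?_
  refine (Finset.sum_le_sum fun c _ => ?_).trans (sum_range_min_le hy n)
  have hl : (Finset.univ.lcm fun _ : Fin 2 => c) ≤ c := by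
    rcases Nat.eq_zero_or_pos c with rfl | hc
    · rw [Nat.le_zero, Finset.lcm_eq_zero_iff]
      exact ⟨0, Finset.mem_univ _, rfl⟩
    · exact Nat.le_of_dvd hc (Finset.lcm_dvd fun _ _ => dvd_rfl)
  have hl' : ((Finset.univ.lcm fun _ : Fin 2 => c : ℕ) : ℝ) ≤ c := by exact_mod_cast hl
  have hy0 : 0 < y := by linarith
  exact mul_le_mul (abs_lcmWeight_two_le c)
    (min_le_min_left 1 (div_le_div_of_nonneg_right hl' hy0.le)) (by positivity) (by positivity)

theorem natLcmSum_two_sub_isBigO :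
    (fun x : ℝ => natLcmSum 2 x - lcmConst 2 / (2 ^ 2 * (Nat.factorial 2 : ℝ)) * x ^ 2)
      =O[atTop] fun x : ℝ => x ^ (3 / 2 : ℝ) * Real.log x := by
  refine IsBigO.of_bound 16 ?_
  filter_upwards [eventually_ge_atTop (Real.exp 1)] with x hx
  have hx1 : 1 ≤ x := (Real.one_le_exp zero_le_one).trans hx
  have hx0 : 0 < x := by linarith
  -- This absorbs the constant: the final factor `4 (3 + log x / 2)` is at most `14 log x`, within
  -- the chosen `16 log x`.
  have hlog : 1 ≤ Real.log x := (Real.le_log_iff_exp_le hx0).2 hx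
  have h := (abs_natLcmSum_sub_le_tsum 1 hx0).2
  have hy : 1 ≤ √x := Real.one_le_sqrt.2 hx1
  have h1 := tsum_lcmWeight_two_le hy
  have hR : 0 ≤ x ^ (3 / 2 : ℝ) * Real.log x :=
    mul_nonneg (Real.rpow_nonneg hx0.le _) (by linarith)
  have h2 : x ^ (3 / 2 : ℝ) = x ^ 2 / √x := by
    rw [Real.sqrt_eq_rpow, ← Real.rpow_natCast, ← Real.rpow_sub hx0]
    norm_num
  rw [Real.log_sqrt hx0.le] at h1
  rw [Real.norm_eq_abs, Real.norm_eq_abs, abs_of_nonneg hR, h2]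
  refine h.trans ((mul_le_mul_of_nonneg_left h1 (by positivity)).trans ?_)
  have h3 : 2 * ((1 + 1 : ℕ) : ℝ) * x ^ (1 + 1) * ((3 + Real.log x / 2) / √x) =
      x ^ 2 / √x * (4 * (3 + Real.log x / 2)) := by
    push_cast
    ring
  rw [h3, mul_left_comm (16 : ℝ)]
  exact mul_le_mul_of_nonneg_left (by linarith) (by positivity)

/-! ### From positive tuples to integer tuples -/

/-- Tuples with a zero entry contribute `0`; the others come in classes of `2^k` sign choices with
the same absolute values, hence the same lcm. -/
theorem intLcmSum_eq (k : ℕ) (x : ℝ) : intLcmSum k x = 2 ^ k * natLcmSum k x := by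
  classical
  have hmem : ∀ n : Fin k → ℤ, n ∈ (intBall_finite k x).toFinset ↔ ∑ i, (n i : ℝ) ^ 2 ≤ x :=
    fun n => by simp [intBall]
  have h1 : intLcmSum k x = ∑ n ∈ (intBall_finite k x).toFinset with ∀ i, n i ≠ 0,
      ((Finset.univ.lcm n : ℤ) : ℝ) := by
    rw [intLcmSum, Finset.sum_filter_of_ne]
    intro n _ hn i hi
    refine hn ?_
    rw [Int.cast_eq_zero, Finset.lcm_eq_zero_iff]
    exact ⟨i, Finset.mem_univ i, hi⟩
  have hlcm : ∀ n : Fin k → ℤ, ((Finset.univ.lcm n : ℤ) : ℝ) =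
      ((Finset.univ.lcm fun i => (n i).natAbs : ℕ) : ℝ) := by
    intro n
    have h2 : (Finset.univ.lcm n : ℤ) = ((Finset.univ.lcm fun i => (n i).natAbs : ℕ) : ℤ) := by
      have h3 : (Finset.univ.lcm n).natAbs = Finset.univ.lcm fun i => (n i).natAbs := by
        refine Nat.dvd_antisymm ?_ (Finset.lcm_dvd fun i hi =>
          Int.natAbs_dvd_natAbs.2 (Finset.dvd_lcm hi))
        rw [← Int.natCast_dvd_natCast, Int.natCast_natAbs, abs_dvd]
        exact Finset.lcm_dvd fun i hi =>
          Int.dvd_natCast.2 (Finset.dvd_lcm (f := fun i => (n i).natAbs) hi)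
      rw [← h3, Int.natCast_natAbs, Int.abs_eq_normalize, Finset.normalize_lcm]
    rw [h2, Int.cast_natCast]
  rw [h1, natLcmSum, Finset.mul_sum, ← Finset.sum_fiberwise_of_maps_to
    (t := (natBall_finite k x).toFinset) (g := fun n i => (n i).natAbs)]
  · refine Finset.sum_congr rfl fun m hm => ?_
    rw [mem_natBall_toFinset] at hm
    have h2 : (((intBall_finite k x).toFinset.filter fun n => ∀ i, n i ≠ 0).filter
        fun n => (fun i => (n i).natAbs) = m) =
        Fintype.piFinset fun i => ({(m i : ℤ), -(m i : ℤ)} : Finset ℤ) := by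
      ext n
      rw [Finset.mem_filter, Finset.mem_filter, hmem, Fintype.mem_piFinset]
      simp only [Finset.mem_insert, Finset.mem_singleton, ← Int.natAbs_eq_iff]
      refine ⟨fun h i => congrFun h.2 i, fun h => ⟨⟨?_, fun i hi => ?_⟩, funext h⟩⟩
      · refine le_trans (le_of_eq (Finset.sum_congr rfl fun i _ => ?_)) hm.2
        rw [← h i, Nat.cast_natAbs, Int.cast_abs, sq_abs]
      · have := hm.1 i
        rw [← h i, hi] at this
        simp at this
    rw [Finset.sum_congr rfl fun n hn => by rw [hlcm, (Finset.mem_filter.1 hn).2], Finset.sum_const,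
      h2, Fintype.card_piFinset, nsmul_eq_mul]
    have h3 : ∀ i, ({(m i : ℤ), -(m i : ℤ)} : Finset ℤ).card = 2 := fun i =>
      Finset.card_pair (by have := hm.1 i; omega)
    simp [h3]
  · intro n hn
    rw [Finset.mem_filter, hmem] at hn
    rw [mem_natBall_toFinset]
    refine ⟨fun i => Int.natAbs_pos.2 (hn.2 i), ?_⟩
    refine le_trans (le_of_eq (Finset.sum_congr rfl fun i _ => ?_)) hn.1
    rw [Nat.cast_natAbs, Int.cast_abs, sq_abs]

theorem intLcmSum_sub_isBigO {k : ℕ} {f : ℝ → ℝ}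
    (h : (fun x : ℝ => natLcmSum k x - lcmConst k / (2 ^ k * (k.factorial : ℝ)) * x ^ k)
      =O[atTop] f) :
    (fun x : ℝ => intLcmSum k x - lcmConst k / (k.factorial : ℝ) * x ^ k) =O[atTop] f := by
  refine (h.const_mul_left (2 ^ k)).congr_left fun x => ?_
  rw [intLcmSum_eq, mul_sub]
  congr 1
  have : (k.factorial : ℝ) ≠ 0 := by exact_mod_cast k.factorial_ne_zero
  field_simp

theorem mainTheorem4 :
    -- the constants `C_k` are well defined
    (∀ k : ℕ, 2 ≤ k →
      (∀ p : Nat.Primes, Summable (eulerTerm k p)) ∧ Multipliable (eulerFactor k)) ∧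
    -- the asymptotic formulas for `k ≥ 3`, over `ℕ` and over `ℤ`
    (∀ k : ℕ, 3 ≤ k → ∀ ε : ℝ, 0 < ε →
      ((fun x : ℝ => natLcmSum k x - lcmConst k / (2 ^ k * (k.factorial : ℝ)) * x ^ k)
        =O[atTop] fun x : ℝ => x ^ ((k : ℝ) - 1 / 4 + ε)) ∧
      ((fun x : ℝ => intLcmSum k x - lcmConst k / (k.factorial : ℝ) * x ^ k)
        =O[atTop] fun x : ℝ => x ^ ((k : ℝ) - 1 / 4 + ε))) ∧
    -- the asymptotic formulas for `k = 2`, over `ℕ` and over `ℤ`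
    ((fun x : ℝ => natLcmSum 2 x - lcmConst 2 / (2 ^ 2 * (Nat.factorial 2 : ℝ)) * x ^ 2)
      =O[atTop] fun x : ℝ => x ^ (3 / 2 : ℝ) * Real.log x) ∧
    ((fun x : ℝ => intLcmSum 2 x - lcmConst 2 / (Nat.factorial 2 : ℝ) * x ^ 2)
      =O[atTop] fun x : ℝ => x ^ (3 / 2 : ℝ) * Real.log x) ∧
    -- the values of `C_2` and `C_3`
    (lcmConst 2 : ℂ) = riemannZeta 3 / riemannZeta 2 ∧
    Multipliable cubicFactor ∧
    (lcmConst 3 : ℂ) =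
      riemannZeta 3 * riemannZeta 5 * ((∏' p : Nat.Primes, cubicFactor p : ℝ) : ℂ) := by
  refine ⟨fun k hk => ⟨fun p => ?_, multipliable_eulerFactor (by omega)⟩,
    fun k hk ε hε => ⟨natLcmSum_sub_isBigO (by omega) hε,
      intLcmSum_sub_isBigO (natLcmSum_sub_isBigO (by omega) hε)⟩,
    natLcmSum_two_sub_isBigO, intLcmSum_sub_isBigO natLcmSum_two_sub_isBigO, lcmConst_two,
    multipliable_cubicFactor, lcmConst_three⟩
  obtain ⟨k, rfl⟩ := Nat.exists_eq_add_of_le' ((by omega : 1 ≤ 2).trans hk)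
  exact summable_eulerTerm k p
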